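/- Let $\mathcal X$ be a finite alphabet and let $P_1,P_2$ be probability distributions on $\mathcal X$ with full support. Write $D(\cdot\|\cdot)$ for the Kullback--Leibler divergence (natural logarithm), $\mathrm{GJS}(P,Q,\alpha)=\alpha D\big(P\,\big\|\,\tfrac{\alpha P+Q}{1+\alpha}\big)+D\big(Q\,\big\|\,\tfrac{\alpha P+Q}{1+\alpha}\big)$ for $\alpha>0$, and $C(P,Q)=-\min_{\eta\in[0,1]}\log\sum_x P(x)^\eta Q(x)^{1-\eta}$. Two training sequences $X_1^N\sim P_1^N$, $X_2^N\sim P_2^N$ and a stream $Y_1,Y_2,\dots$ of test samples, i.i.d. with law $P_i$ under hypothesis $H_i$ $(i=1,2)$, are observed, all samples being independent; $\mathsf T_{x}$ denotes the empirical distribution of a finite sequence $x$. A test is a pair $(T,d)$ of a stopping time $T$ of the filtration $\sigma(X_1^N,X_2^N,Y_1,\dots,Y_n)$ and a decision $d\in\{H_1,H_2\}$ based on the data up to time $T$. For a prior $(\pi_1,\pi_2)$ with $\pi_1\in(0,1)$, $\pi_2=1-\pi_1$, the Bayesian error exponent of a family of tests $\Phi=(\Phi_N)_N$ is $\mathsf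 e(\Phi)=\liminf_{N\to\infty}-\frac1N\log\big(\pi_1\mathrm P_1(d\ne H_1)+\pi_2\mathrm P_2(d\neq H_2)\big)$. Sequential test $\Phi_{\mathrm{seq}}(\gamma)$: with $S_i(n)=n\,\mathrm{GJS}(\mathsf T_{X_i^N},\mathsf T_{Y^n},N/n)$, stop at $T=\min\big(\inf\{n\ge1: S_1(n)\ge\gamma N\text{ or }S_2(n)\ge\gamma N\},\,N^2\big)$ and decide $H_1$ if only $S_2(T)\ge\gamma N$, $H_2$ if only $S_1(T)\ge\gamma N$ (and arbitrarily if both or neither hold). Gutman's test $\Phi_{\mathrm{GUT}}(\lambda,\alpha)$ with $n$ test samples: decide $H_1$ if $\mathrm{GJS}(\mathsf T_{X_1^N},\mathsf T_{Y^n},\alpha)<\lambda\alpha$, $H_2$ if it is $>\lambda\alpha$ (and arbitrarily in case of equality). Put $$F_1(\alpha,\lambda)=\min\Big\{D(Q_1\|P_1)+\tfrac1\alpha D(Q_2\|P_2)\ :\ \tfrac1\alpha\mathrm{GJS}(Q_1,Q_2,\alpha)\le\lambda\Big\},$$ the minimum being over pairs of probability distributions on $\mathcal X$. **Theorem.** Let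 $\gamma\in(0,C(P_1,P_2)]$, let $\beta^\star_\gamma>0$ and $\theta^\star_\gamma>0$ be the solutions of $\mathrm{GJS}(P_2,P_1,\beta^\star_\gamma)=\gamma\beta^\star_\gamma$ and $\mathrm{GJS}(P_1,P_2,\theta^\star_\gamma)=\gamma\theta^\star_\gamma$, and let $\alpha=\min\{\theta^\star_\gamma,\beta^\star_\gamma\}$. Suppose that Gutman's test is given $n=n_N$ test samples with $N/n_N\to\alpha$ (that is, $N/\min\{\theta^\star_\gamma,\beta^\star_\gamma\}$ test samples up to rounding), and that it uses its optimal threshold $\lambda^\star\ge 0$, the maximizer of $\lambda\mapsto\min\{\lambda,F_1(\alpha,\lambda)\}$ over $\lambda\ge0$. Then $$\mathsf e\big(\Phi_{\mathrm{GUT}}(\lambda^\star,\alpha)\big)<\gamma\le\mathsf e\big(\Phi_{\mathrm{seq}}(\gamma)\big),$$ so the Bayesian error exponent $\gamma$ that the sequential test is guaranteed to achieve, and a fortiori its Bayesian error exponent, is strictly greater than that of Gutman's test. -/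

import Mathlib

open Filter Topology MeasureTheory

namespace SeqClass

noncomputable section

/-! ### Information measures on a finite alphabet -/

/-- Kullback-Leibler divergence `D(P‖Q)` (natural logarithm, `0 log 0 = 0`) of two probability
vectors, for `P` absolutely continuous with respect to `Q`. Below it is only evaluated at such
pairs: the second argument has full support or is a mixture that charges the first one. -/
def kl {X : Type*} [Fintype X] (P Q : X → ℝ) : ℝ :=
  ∑ a, P a * Real.log (P a / Q a)

/-- The mixture `(α P + Q) / (1 + α)`. -/
def mix {X : Type*} (P Q : X → ℝ) (α : ℝ) : X → ℝ :=
  fun a => (α * P a + Q a) / (1 + α)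

/-- Generalized Jensen-Shannon divergence `GJS(P, Q, α)`. -/
def gjs {X : Type*} [Fintype X] (P Q : X → ℝ) (α : ℝ) : ℝ :=
  α * kl P (mix P Q α) + kl Q (mix P Q α)

/-- Chernoff information `C(P, Q) = - min_{η ∈ [0,1]} log ∑ P^η Q^(1-η)`. -/
def chernoff {X : Type*} [Fintype X] (P Q : X → ℝ) : ℝ :=
  - sInf ((fun η : ℝ => Real.log (∑ a, P a ^ η * Q a ^ (1 - η))) '' Set.Icc 0 1)

/-- The probability vector of a distribution. -/
def vec {X : Type*} (P : PMF X) : X → ℝ := fun a => (P a).toReal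

/-- The type (empirical distribution) of a sequence of length `n`. -/
def empType {X : Type*} [DecidableEq X] {n : ℕ} (x : Fin n → X) : X → ℝ :=
  fun a => (∑ i, if x i = a then (1 : ℝ) else 0) / n

/-- `F₁(α, lam)`: the minimum of `D(Q₁‖P₁) + D(Q₂‖P₂) / α` over all pairs of probability vectors
with `GJS(Q₁, Q₂, α) / α ≤ lam`. -/
def gutmanTradeoff {X : Type*} [Fintype X] (P₁ P₂ : X → ℝ) (α lam : ℝ) : ℝ :=
  sInf {v : ℝ | ∃ Q₁ ∈ stdSimplex ℝ X, ∃ Q₂ ∈ stdSimplex ℝ X,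
    gjs Q₁ Q₂ α / α ≤ lam ∧ v = kl Q₁ P₁ + kl Q₂ P₂ / α}

/-- `lam ≥ 0` attains `max_{lam ≥ 0} min {lam, F₁(α, lam)}`. -/
def IsOptimalThreshold {X : Type*} [Fintype X] (P₁ P₂ : X → ℝ) (α lam : ℝ) : Prop :=
  0 ≤ lam ∧ IsMaxOn (fun l => min l (gutmanTradeoff P₁ P₂ α l)) (Set.Ici 0) lam

/-! ### Tests and their error probabilities -/

/-- The two hypotheses: the test samples come from the source of the first, respectively the
second, training sequence. -/
inductive Hyp where
  | H₁ : Hyp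
  | H₂ : Hyp

/-- The data: two training sequences of length `N` and the stream `Y₁, Y₂, …` of test samples
(`Yₖ` is the entry with index `k - 1`). -/
structure Data (X : Type*) (N : ℕ) where
  /-- the two training sequences -/
  train : Hyp → Fin N → X
  /-- the test samples -/
  test : ℕ → X

/-- The first `n` test samples. -/
def Data.prefix {X : Type*} {N : ℕ} (ω : Data X N) (n : ℕ) : Fin n → X :=
  fun k => ω.test k

/-- Two data sets that agree on the training sequences and on the first `n` test samples, that is,
that cannot be told apart by `σ(X₁^N, X₂^N, Y₁, …, Yₙ)`. -/
def Data.Agree {X : Type*} {N : ℕ} (n : ℕ) (ω ω' : Data X N) : Prop :=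
  ω.train = ω'.train ∧ ∀ k < n, ω.test k = ω'.test k

/-- A test `(T, d)`: a stopping time `T` of the filtration generated by the training sequences and
the test samples, and a decision `d` that depends only on the data seen up to time `T`. (The
alphabet being finite, the two fields below say exactly `{T = n} ∈ ℱₙ` and `d` is
`ℱ_T`-measurable.) -/
structure Test (X : Type*) (N : ℕ) where
  /-- stopping time -/
  T : Data X N → ℕ
  /-- decision -/
  d : Data X N → Hyp
  stopping : ∀ ω ω', Data.Agree (T ω) ω ω' → T ω' = T ω
  adapted : ∀ ω ω', Data.Agree (T ω) ω ω' → d ω' = d ω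

/-- The distribution of the samples attached to a hypothesis. -/
def source {X : Type*} (P₁ P₂ : PMF X) : Hyp → PMF X
  | .H₁ => P₁
  | .H₂ => P₂

/-- The law of (first training sequence, second training sequence, test samples) under hypothesis
`i`: all samples are independent, the training samples have the laws `P₁` and `P₂`, and the test
samples have the law `P_i`. -/
def law {X : Type*} [MeasurableSpace X] (P₁ P₂ : PMF X) (N : ℕ) (i : Hyp) :
    Measure ((Fin N → X) × (Fin N → X) × (ℕ → X)) :=
  (Measure.pi fun _ => P₁.toMeasure).prod
    ((Measure.pi fun _ => P₂.toMeasure).prod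
      (Measure.infinitePi fun _ => (source P₁ P₂ i).toMeasure))

/-- Assemble the data from the three sample sequences. -/
def toData {X : Type*} {N : ℕ} (s : (Fin N → X) × (Fin N → X) × (ℕ → X)) : Data X N where
  train := fun
    | .H₁ => s.1
    | .H₂ => s.2.1
  test := s.2.2

/-- The error probability `P_i(d ≠ H_i)` of a test under hypothesis `i`. -/
def errProb {X : Type*} [MeasurableSpace X] (P₁ P₂ : PMF X) {N : ℕ} (Φ : Test X N) (i : Hyp) :
    ENNReal :=
  law P₁ P₂ N i {s | Φ.d (toData s) ≠ i}

/-- The average error probability for the prior `(p, 1 - p)` on the hypotheses. -/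
def bayesErr {X : Type*} [MeasurableSpace X] (P₁ P₂ : PMF X) (p : ℝ) {N : ℕ} (Φ : Test X N) :
    ENNReal :=
  ENNReal.ofReal p * errProb P₁ P₂ Φ .H₁ + ENNReal.ofReal (1 - p) * errProb P₁ P₂ Φ .H₂

/-- The Bayesian error exponent `liminf_N (- log P^err) / N` of a family of tests (an extended
real; `- log 0 = ∞`). -/
def bayesExponent {X : Type*} [MeasurableSpace X] (P₁ P₂ : PMF X) (p : ℝ)
    (Φ : ∀ N : ℕ, Test X N) : EReal :=
  liminf (fun N : ℕ => - ENNReal.log (bayesErr P₁ P₂ p (Φ N)) / (N : EReal)) atTop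

/-! ### The sequential test and Gutman's test -/

/-- The score of class `i` at time `n`: `n · GJS(type of X_i^N, type of Y^n, N / n)`. -/
def score {X : Type*} [Fintype X] [DecidableEq X] {N : ℕ} (i : Hyp) (n : ℕ) (ω : Data X N) : ℝ :=
  n * gjs (empType (ω.train i)) (empType (ω.prefix n)) ((N : ℝ) / n)

/-- The stopping time of the sequential test with threshold `γ`:
`inf {n ≥ 1 : some class has score ≥ γ N at time n} ∧ N²`. -/
def seqTime {X : Type*} [Fintype X] [DecidableEq X] {N : ℕ} (γ : ℝ) (ω : Data X N) : ℕ :=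
  sInf ({n : ℕ | 1 ≤ n ∧ ∃ i : Hyp, γ * N ≤ score i n ω} ∪ {N ^ 2})

/-- `Φ` is the sequential test with threshold `γ`: it stops at `seqTime γ`, and it decides for `H₁`
if it is the score of class 2 that has reached the threshold, and for `H₂` if it is that of
class 1. When both or neither of the scores have reached the threshold at that time, the rule
does not single out a decision and `Φ` may take either one. -/
def IsSeqTest {X : Type*} [Fintype X] [DecidableEq X] {N : ℕ} (γ : ℝ) (Φ : Test X N) : Prop :=
  ∀ ω : Data X N, Φ.T ω = seqTime γ ω ∧
    (γ * N ≤ score .H₂ (Φ.T ω) ω → score .H₁ (Φ.T ω) ω < γ * N → Φ.d ω = .H₁) ∧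
    (γ * N ≤ score .H₁ (Φ.T ω) ω → score .H₂ (Φ.T ω) ω < γ * N → Φ.d ω = .H₂)

/-- `Φ` is Gutman's test with threshold `lam` and ratio `α` that uses exactly `n` test samples: it
decides for `H₁` if `GJS(type of X₁^N, type of Y^n, α)` is below `lam * α`, and for `H₂` if it is
above. In the case of equality `Φ` may take either decision. -/
def IsGutmanTest {X : Type*} [Fintype X] [DecidableEq X] {N : ℕ} (lam α : ℝ) (n : ℕ)
    (Φ : Test X N) : Prop :=
  ∀ ω : Data X N, Φ.T ω = n ∧
    (gjs (empType (ω.train .H₁)) (empType (ω.prefix n)) α < lam * α → Φ.d ω = .H₁) ∧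
    (lam * α < gjs (empType (ω.train .H₁)) (empType (ω.prefix n)) α → Φ.d ω = .H₂)

end

end SeqClass

open SeqClass

/-! Both exponents come from the method of types: up to polynomial factors, a sequence of `n`
samples of law `P` has type `Q` with probability `exp (-n D(Q‖P))`.

Gutman's test errs under `H₂` whenever the types fall near a pair with `GJS / α < λ⋆`, so it
suffices to find such a pair of cost `D(Q₁‖P₁) + D(Q₂‖P₂) / α < γ`. If `V` is the mixture with
`GJS(P₁, P₂, α) = α D(P₁‖V) + D(P₂‖V)`, the normalised geometric means of `P₁, V` and of `P₂, V`
form a pair whose cost and `GJS / α` add up to less than `GJS(P₁, P₂, α) / α ≤ γ`. If instead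
`GJS(P₂, P₁, α) ≤ γ α`, reflecting the vector `√V` in the hyperplane that exchanges `√P₁` and `√P₂`
exchanges the two sources without changing the Bhattacharyya coefficients involved. Optimality of
`λ⋆` yields a pair with `GJS / α` and cost both at most `λ⋆`, and moving along a segment makes both
inequalities strict.

The sequential test errs only if the score of the true class reaches `γ N` at one of at most `N²`
times, which has exponent `γ` since `n GJS` is at most the cost, or if the score of the wrong class
is still below `γ N` at time `N²`. In the latter case either the type of the test samples is at
divergence `γ / N` from its source, or it is so close to it that the training type of the wrong
class is within `γ` of the true source, hence by the Chernoff bound at distance at least `γ` from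
its own. -/

namespace SeqClass

section Divergence

lemma sq_sqrt_sub_sqrt_add_sub_le {q p : ℝ} (hq : 0 ≤ q) (hp : 0 ≤ p) (h : p = 0 → q = 0) :
    (√q - √p) ^ 2 + (q - p) ≤ q * Real.log (q / p) := by
  rcases hq.eq_or_lt with rfl | hq
  · simp [Real.sq_sqrt hp]
  have hp : 0 < p := hp.lt_of_ne' fun hp₀ => hq.ne' (h hp₀)
  have hlog : Real.log (q / p) = 2 * Real.log (√q / √p) := by
    rw [← Real.sqrt_div hq.le, Real.log_sqrt (by positivity)]
    ring
  calc (√q - √p) ^ 2 + (q - p) = 2 * √q ^ 2 - 2 * √q * √p := by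
        linear_combination -Real.sq_sqrt hq.le + Real.sq_sqrt hp.le
    _ = q * (2 * (1 - (√q / √p)⁻¹)) := by
        rw [inv_div, ← mul_left_cancel_iff_of_pos (Real.sqrt_pos.2 hq)]
        field_simp
        rw [Real.sq_sqrt hq.le]
        ring
    _ ≤ q * Real.log (q / p) := by
        rw [hlog]
        gcongr
        exact Real.one_sub_inv_le_log_of_pos (by positivity)

lemma mul_log_div (x : ℝ) {q : ℝ} (hq : q ≠ 0) :
    x * Real.log (x / q) = x * Real.log x - x * Real.log q := by
  rcases eq_or_ne x 0 with rfl | hx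
  · simp
  · rw [Real.log_div hx hq, mul_sub]

variable {X : Type*} [Fintype X] {P Q R : X → ℝ}

lemma kl_self (P : X → ℝ) : kl P P = 0 := by simp [kl]

lemma kl_eq_kl_add (hQ : P.support ⊆ Q.support) (hR : P.support ⊆ R.support) :
    kl P Q = kl P R + ∑ a, P a * Real.log (R a / Q a) := by
  simp only [kl, ← Finset.sum_add_distrib]
  refine Finset.sum_congr rfl fun a _ => ?_
  by_cases hP : P a = 0
  · simp [hP]
  · rw [Real.log_div hP (hQ hP), Real.log_div hP (hR hP), Real.log_div (hR hP) (hQ hP)]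
    ring

lemma sum_sq_sqrt_sub_sqrt_le_kl (hP : P ∈ stdSimplex ℝ X) (hQ : Q ∈ stdSimplex ℝ X)
    (h : P.support ⊆ Q.support) : ∑ a, (√(P a) - √(Q a)) ^ 2 ≤ kl P Q :=
  calc ∑ a, (√(P a) - √(Q a)) ^ 2 = ∑ a, ((√(P a) - √(Q a)) ^ 2 + (P a - Q a)) := by
        rw [Finset.sum_add_distrib, Finset.sum_sub_distrib, hP.2, hQ.2, sub_self, add_zero]
    _ ≤ kl P Q := Finset.sum_le_sum fun a _ =>
        sq_sqrt_sub_sqrt_add_sub_le (hP.1 a) (hQ.1 a) fun hQa => of_not_not fun hPa => h hPa hQa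

lemma kl_nonneg (hP : P ∈ stdSimplex ℝ X) (hQ : Q ∈ stdSimplex ℝ X)
    (h : P.support ⊆ Q.support) : 0 ≤ kl P Q :=
  (Finset.sum_nonneg fun _ _ => sq_nonneg _).trans (sum_sq_sqrt_sub_sqrt_le_kl hP hQ h)

lemma dist_le_sqrt_kl (hP : P ∈ stdSimplex ℝ X) (hQ : Q ∈ stdSimplex ℝ X)
    (h : P.support ⊆ Q.support) : dist P Q ≤ √(4 * kl P Q) := by
  refine (dist_pi_le_iff (Real.sqrt_nonneg _)).2 fun a => Real.abs_le_sqrt ?_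
  have sqrt_le_one : ∀ {R : X → ℝ}, R ∈ stdSimplex ℝ X → √(R a) ≤ 1 := fun hR =>
    Real.sqrt_le_one.2 (mem_Icc_of_mem_stdSimplex hR a).2
  have hsum : (√(P a) + √(Q a)) ^ 2 ≤ 2 ^ 2 := by
    gcongr
    linarith [sqrt_le_one hP, sqrt_le_one hQ]
  calc (P a - Q a) ^ 2 = (√(P a) + √(Q a)) ^ 2 * (√(P a) - √(Q a)) ^ 2 := by
        rw [← mul_pow, ← sq_sub_sq, Real.sq_sqrt (hP.1 a), Real.sq_sqrt (hQ.1 a)]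
    _ ≤ 2 ^ 2 * ∑ b, (√(P b) - √(Q b)) ^ 2 := by
        gcongr
        exact Finset.single_le_sum (f := fun b => (√(P b) - √(Q b)) ^ 2)
          (fun b _ => sq_nonneg _) (Finset.mem_univ a)
    _ ≤ 4 * kl P Q := by linarith [sum_sq_sqrt_sub_sqrt_le_kl hP hQ h]

lemma eq_of_kl_nonpos (hP : P ∈ stdSimplex ℝ X) (hQ : Q ∈ stdSimplex ℝ X)
    (h : P.support ⊆ Q.support) (h₀ : kl P Q ≤ 0) : P = Q := by
  refine dist_le_zero.1 ((dist_le_sqrt_kl hP hQ h).trans_eq (Real.sqrt_eq_zero_of_nonpos ?_))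
  linarith

lemma continuous_kl_left (Q : X → ℝ) : Continuous fun P => kl P Q := by
  refine continuous_finsetSum _ fun a _ => ?_
  rcases eq_or_ne (Q a) 0 with hQ | hQ
  · simpa [hQ] using continuous_const
  · simp only [mul_log_div _ hQ]
    exact (Real.continuous_mul_log.comp (continuous_apply a)).sub (by fun_prop)

lemma convexOn_kl_left (Q : X → ℝ) : ConvexOn ℝ (Set.Ici 0) fun P => kl P Q := by
  have convexOn_term : ∀ q : ℝ, ConvexOn ℝ (Set.Ici 0) fun x => x * Real.log (x / q) := fun q => by
    rcases eq_or_ne q 0 with rfl | hq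
    · simpa using convexOn_const 0 (convex_Ici 0)
    · simp only [mul_log_div _ hq]
      exact Real.convexOn_mul_log.sub
        (((LinearMap.mulRight ℝ (Real.log q)).concaveOn (convex_Ici 0)))
  refine ⟨convex_Ici 0, fun P hP R hR s t hs ht hst => ?_⟩
  simp only [kl, smul_eq_mul, Finset.mul_sum, ← Finset.sum_add_distrib]
  exact Finset.sum_le_sum fun a _ => (convexOn_term (Q a)).2 (hP a) (hR a) hs ht hst

end Divergence

section JensenShannon

variable {X : Type*} {P Q : X → ℝ} {α : ℝ}

lemma support_subset_support_mix_left (hP : 0 ≤ P) (hQ : 0 ≤ Q) (hα : 0 < α) :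
    P.support ⊆ (mix P Q α).support := fun a ha => by
  have hPa : 0 < P a := (hP a).lt_of_ne' ha
  have hQa : 0 ≤ Q a := hQ a
  exact (show 0 < (α * P a + Q a) / (1 + α) by positivity).ne'

lemma support_subset_support_mix_right (hP : 0 ≤ P) (hQ : 0 ≤ Q) (hα : 0 ≤ α) :
    Q.support ⊆ (mix P Q α).support := fun a ha => by
  have hPa : 0 ≤ P a := hP a
  have hQa : 0 < Q a := (hQ a).lt_of_ne' ha
  exact (show 0 < (α * P a + Q a) / (1 + α) by positivity).ne'

lemma eq_of_mix_eq_left (hα : 0 ≤ α) (h : mix P Q α = P) : P = Q := by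
  funext a
  have ha := congrFun h a
  rw [mix, div_eq_iff (by positivity)] at ha
  linear_combination -ha

lemma eq_of_mix_eq_right (hα : 0 < α) (h : mix P Q α = Q) : P = Q := by
  funext a
  have ha := congrFun h a
  rw [mix, div_eq_iff (by positivity)] at ha
  exact mul_left_cancel₀ hα.ne' (by linear_combination ha)

lemma continuous_mix (α : ℝ) : Continuous fun Q : (X → ℝ) × (X → ℝ) => mix Q.1 Q.2 α := by
  unfold mix
  fun_prop

variable [Fintype X] {V : X → ℝ}

lemma mix_mem_stdSimplex (hP : P ∈ stdSimplex ℝ X) (hQ : Q ∈ stdSimplex ℝ X) (hα : 0 ≤ α) :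
    mix P Q α ∈ stdSimplex ℝ X := by
  refine ⟨fun a => div_nonneg (add_nonneg (mul_nonneg hα (hP.1 a)) (hQ.1 a)) (by positivity), ?_⟩
  simp only [mix, ← Finset.sum_div, Finset.sum_add_distrib, ← Finset.mul_sum, hP.2, hQ.2]
  rw [mul_one, add_comm, div_self (by positivity)]

lemma dist_mix_right_le (hP : P ∈ stdSimplex ℝ X) (hQ : Q ∈ stdSimplex ℝ X) (hα : 0 ≤ α) :
    dist (mix P Q α) Q ≤ α := by
  refine (dist_pi_le_iff hα).2 fun a => ?_
  calc |mix P Q α a - Q a| = |α / (1 + α) * (P a - Q a)| := by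
        rw [mix]
        congr 1
        field_simp
        ring
    _ = α / (1 + α) * dist (P a) (Q a) := by
        rw [abs_mul, abs_of_nonneg (by positivity), Real.dist_eq]
    _ ≤ α * 1 := by
        gcongr
        · exact div_le_self hα (by linarith)
        · exact Real.dist_le_of_mem_Icc_01 (mem_Icc_of_mem_stdSimplex hP a)
            (mem_Icc_of_mem_stdSimplex hQ a)
    _ = α := mul_one α

lemma gjs_add_kl_mix (hP : 0 ≤ P) (hQ : 0 ≤ Q) (hα : 0 < α) (hPV : P.support ⊆ V.support)
    (hQV : Q.support ⊆ V.support) :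
    gjs P Q α + (1 + α) * kl (mix P Q α) V = α * kl P V + kl Q V := by
  have hmix : (1 + α) * kl (mix P Q α) V =
      α * ∑ a, P a * Real.log (mix P Q α a / V a) + ∑ a, Q a * Real.log (mix P Q α a / V a) := by
    simp only [kl, Finset.mul_sum, ← Finset.sum_add_distrib]
    refine Finset.sum_congr rfl fun a _ => ?_
    rw [← mul_assoc, show (1 + α) * mix P Q α a = α * P a + Q a from
      mul_div_cancel₀ _ (by positivity)]
    ring
  rw [gjs, hmix, kl_eq_kl_add hPV (support_subset_support_mix_left hP hQ hα),
    kl_eq_kl_add hQV (support_subset_support_mix_right hP hQ hα.le)]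
  ring

lemma gjs_le (hP : P ∈ stdSimplex ℝ X) (hQ : Q ∈ stdSimplex ℝ X) (hα : 0 < α)
    (hV : V ∈ stdSimplex ℝ X) (hPV : P.support ⊆ V.support) (hQV : Q.support ⊆ V.support) :
    gjs P Q α ≤ α * kl P V + kl Q V := by
  have hsupp : (mix P Q α).support ⊆ V.support :=
    Function.support_subset_iff'.2 fun a ha => by
      simp [mix, Function.support_subset_iff'.1 hPV a ha, Function.support_subset_iff'.1 hQV a ha]
  have hkl := kl_nonneg (mix_mem_stdSimplex hP hQ hα.le) hV hsupp
  have := gjs_add_kl_mix hP.1 hQ.1 hα hPV hQV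
  nlinarith

lemma kl_mix_left_nonneg (hP : P ∈ stdSimplex ℝ X) (hQ : Q ∈ stdSimplex ℝ X) (hα : 0 < α) :
    0 ≤ kl P (mix P Q α) :=
  kl_nonneg hP (mix_mem_stdSimplex hP hQ hα.le) (support_subset_support_mix_left hP.1 hQ.1 hα)

lemma kl_mix_right_nonneg (hP : P ∈ stdSimplex ℝ X) (hQ : Q ∈ stdSimplex ℝ X) (hα : 0 ≤ α) :
    0 ≤ kl Q (mix P Q α) :=
  kl_nonneg hQ (mix_mem_stdSimplex hP hQ hα) (support_subset_support_mix_right hP.1 hQ.1 hα)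

lemma kl_mix_left_le (hP : P ∈ stdSimplex ℝ X) (hQ : Q ∈ stdSimplex ℝ X) (hα : 0 < α) :
    kl P (mix P Q α) ≤ gjs P Q α / α := by
  rw [le_div_iff₀' hα, gjs]
  exact le_add_of_nonneg_right (kl_mix_right_nonneg hP hQ hα.le)

lemma gjs_self (P : X → ℝ) (hα : 0 ≤ α) : gjs P P α = 0 := by
  have hmix : mix P P α = P := funext fun a => by
    rw [mix, div_eq_iff (by positivity)]
    ring
  simp [gjs, hmix, kl_self]

lemma eq_of_gjs_nonpos (hP : P ∈ stdSimplex ℝ X) (hQ : Q ∈ stdSimplex ℝ X) (hα : 0 < α)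
    (h : gjs P Q α ≤ 0) : P = Q := by
  have hmix := mix_mem_stdSimplex hP hQ hα.le
  have hPkl := mul_nonneg hα.le (kl_mix_left_nonneg hP hQ hα)
  have hQkl := kl_mix_right_nonneg hP hQ hα.le
  rw [gjs] at h
  rw [eq_of_kl_nonpos hP hmix (support_subset_support_mix_left hP.1 hQ.1 hα)
      (nonpos_of_mul_nonpos_right (by linarith) hα),
    ← eq_of_kl_nonpos hQ hmix (support_subset_support_mix_right hP.1 hQ.1 hα.le) (by linarith)]

lemma continuousOn_gjs (hα : 0 < α) :
    ContinuousOn (fun Q : (X → ℝ) × (X → ℝ) => gjs Q.1 Q.2 α) (Set.Ici 0) := by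
  have hent : Continuous fun Q : (X → ℝ) × (X → ℝ) =>
      α * kl Q.1 1 + kl Q.2 1 - (1 + α) * kl (mix Q.1 Q.2 α) 1 :=
    (((continuous_kl_left 1).comp continuous_fst).const_mul α |>.add
      ((continuous_kl_left 1).comp continuous_snd)).sub
      (((continuous_kl_left 1).comp (continuous_mix α)).const_mul _)
  refine hent.continuousOn.congr fun Q hQ => eq_sub_of_add_eq ?_
  exact gjs_add_kl_mix hQ.1 hQ.2 hα (fun _ _ => one_ne_zero) fun _ _ => one_ne_zero

-- The mixture of the original pair serves as the reference vector for the contracted pair.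
lemma gjs_lineMap_mix_le (hP : P ∈ stdSimplex ℝ X) (hQ : Q ∈ stdSimplex ℝ X) (hα : 0 < α)
    {t : ℝ} (ht : t ∈ Set.Icc (0 : ℝ) 1) :
    gjs (AffineMap.lineMap P (mix P Q α) t) (AffineMap.lineMap Q (mix P Q α) t) α ≤
      (1 - t) * gjs P Q α := by
  have hmix := mix_mem_stdSimplex hP hQ hα.le
  have hmem : ∀ {R : X → ℝ}, R ∈ stdSimplex ℝ X →
      AffineMap.lineMap R (mix P Q α) t ∈ stdSimplex ℝ X := fun hR =>
    (convex_stdSimplex ℝ X).lineMap_mem hR hmix ht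
  have hsupp : ∀ {R : X → ℝ}, R.support ⊆ (mix P Q α).support →
      (AffineMap.lineMap R (mix P Q α) t).support ⊆ (mix P Q α).support := fun hR =>
    Function.support_subset_iff'.2 fun a ha => by
      simp [AffineMap.lineMap_apply_module, Function.notMem_support.1 ha,
        Function.support_subset_iff'.1 hR a ha]
  have hkl : ∀ {R : X → ℝ}, R ∈ stdSimplex ℝ X →
      kl (AffineMap.lineMap R (mix P Q α) t) (mix P Q α) ≤ (1 - t) * kl R (mix P Q α) :=
    fun {R} hR => by
      have := (convexOn_kl_left (mix P Q α)).2 (x := R) (y := mix P Q α) hR.1 hmix.1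
        (sub_nonneg.2 ht.2) ht.1 (sub_add_cancel 1 t)
      simpa [AffineMap.lineMap_apply_module, kl_self] using this
  calc _ ≤ α * kl (AffineMap.lineMap P (mix P Q α) t) (mix P Q α) +
        kl (AffineMap.lineMap Q (mix P Q α) t) (mix P Q α) :=
        gjs_le (hmem hP) (hmem hQ) hα hmix
          (hsupp (support_subset_support_mix_left hP.1 hQ.1 hα))
          (hsupp (support_subset_support_mix_right hP.1 hQ.1 hα.le))
    _ ≤ α * ((1 - t) * kl P (mix P Q α)) + (1 - t) * kl Q (mix P Q α) := by
        gcongr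
        exacts [hkl hP, hkl hQ]
    _ = (1 - t) * gjs P Q α := by
        rw [gjs]
        ring

end JensenShannon

section Chernoff

variable {X : Type*} [Fintype X] {P Q R : X → ℝ} {η : ℝ}

/-- The Chernoff coefficient `∑ P^η Q^(1-η)`, whose logarithm is minimised over `η ∈ [0, 1]` in
`chernoff P Q`; for `η = 1/2` it is the Bhattacharyya coefficient. -/
noncomputable def chernoffCoeff (P Q : X → ℝ) (η : ℝ) : ℝ := ∑ a, P a ^ η * Q a ^ (1 - η)

/-- The normalised geometric mean `P^η Q^(1-η) / ∑ P^η Q^(1-η)` of two probability vectors: the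
minimiser of `R ↦ η D(R‖P) + (1 - η) D(R‖Q)`. -/
noncomputable def geoMix (P Q : X → ℝ) (η : ℝ) : X → ℝ :=
  fun a => P a ^ η * Q a ^ (1 - η) / chernoffCoeff P Q η

lemma chernoffCoeff_pos (hP : 0 ≤ P) (hQ : 0 ≤ Q) (η : ℝ)
    (h : (P.support ∩ Q.support).Nonempty) : 0 < chernoffCoeff P Q η := by
  obtain ⟨a, hPa, hQa⟩ := h
  refine Finset.sum_pos' (fun b _ => ?_) ⟨a, Finset.mem_univ a, ?_⟩
  · exact mul_nonneg (Real.rpow_nonneg (hP b) _) (Real.rpow_nonneg (hQ b) _)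
  · exact mul_pos (Real.rpow_pos_of_pos ((hP a).lt_of_ne' hPa) _)
      (Real.rpow_pos_of_pos ((hQ a).lt_of_ne' hQa) _)

lemma geoMix_mem_stdSimplex (hP : 0 ≤ P) (hQ : 0 ≤ Q) (η : ℝ)
    (h : (P.support ∩ Q.support).Nonempty) : geoMix P Q η ∈ stdSimplex ℝ X := by
  have hZ := chernoffCoeff_pos hP hQ η h
  refine ⟨fun a => ?_, ?_⟩
  · exact div_nonneg (mul_nonneg (Real.rpow_nonneg (hP a) _) (Real.rpow_nonneg (hQ a) _)) hZ.le
  · simp only [geoMix]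
    rw [← Finset.sum_div]
    exact div_self hZ.ne'

lemma inter_support_subset_support_geoMix (hP : 0 ≤ P) (hQ : 0 ≤ Q) (η : ℝ) :
    P.support ∩ Q.support ⊆ (geoMix P Q η).support := fun a ha =>
  (div_pos (mul_pos (Real.rpow_pos_of_pos ((hP a).lt_of_ne' ha.1) _)
    (Real.rpow_pos_of_pos ((hQ a).lt_of_ne' ha.2) _)) (chernoffCoeff_pos hP hQ η ⟨a, ha⟩)).ne'

lemma inter_support_nonempty (hR : R ∈ stdSimplex ℝ X) (hRP : R.support ⊆ P.support)
    (hRQ : R.support ⊆ Q.support) : (P.support ∩ Q.support).Nonempty :=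
  (Function.support_nonempty_iff.2 fun h => by simpa [h] using hR.2).mono
    (Set.subset_inter hRP hRQ)

lemma mul_kl_add_mul_kl (hP : 0 ≤ P) (hQ : 0 ≤ Q) (η : ℝ) (hR : R ∈ stdSimplex ℝ X)
    (hRP : R.support ⊆ P.support) (hRQ : R.support ⊆ Q.support) :
    η * kl R P + (1 - η) * kl R Q =
      kl R (geoMix P Q η) - Real.log (chernoffCoeff P Q η) := by
  have hZ := chernoffCoeff_pos hP hQ η (inter_support_nonempty hR hRP hRQ)
  have hRG : R.support ⊆ (geoMix P Q η).support :=
    (Set.subset_inter hRP hRQ).trans (inter_support_subset_support_geoMix hP hQ η)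
  have hlog : ∀ a, η * (R a * Real.log (geoMix P Q η a / P a)) +
      (1 - η) * (R a * Real.log (geoMix P Q η a / Q a)) =
        -(R a * Real.log (chernoffCoeff P Q η)) := fun a => by
    by_cases ha : R a = 0
    · simp [ha]
    have hPa : 0 < P a := (hP a).lt_of_ne' (hRP ha)
    have hQa : 0 < Q a := (hQ a).lt_of_ne' (hRQ ha)
    rw [Real.log_div (hRG ha) (hRP ha), Real.log_div (hRG ha) (hRQ ha), geoMix,
      Real.log_div (by positivity) hZ.ne', Real.log_mul (by positivity) (by positivity),
      Real.log_rpow hPa, Real.log_rpow hQa]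
    ring
  have hsum := Finset.sum_congr (rfl : Finset.univ = Finset.univ) fun a _ => hlog a
  rw [Finset.sum_add_distrib, ← Finset.mul_sum, ← Finset.mul_sum, Finset.sum_neg_distrib,
    ← Finset.sum_mul, hR.2] at hsum
  rw [kl_eq_kl_add hRP hRG, kl_eq_kl_add hRQ hRG]
  linear_combination hsum

lemma neg_log_chernoffCoeff_le (hP : 0 ≤ P) (hQ : 0 ≤ Q) (η : ℝ) (hR : R ∈ stdSimplex ℝ X)
    (hRP : R.support ⊆ P.support) (hRQ : R.support ⊆ Q.support) :
    -Real.log (chernoffCoeff P Q η) ≤ η * kl R P + (1 - η) * kl R Q := by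
  have hG := geoMix_mem_stdSimplex hP hQ η (inter_support_nonempty hR hRP hRQ)
  have hRG := (Set.subset_inter hRP hRQ).trans (inter_support_subset_support_geoMix hP hQ η)
  linarith [mul_kl_add_mul_kl hP hQ η hR hRP hRQ, kl_nonneg hR hG hRG]

lemma exists_chernoff_le (hP : P ∈ stdSimplex ℝ X) (hQ : Q ∈ stdSimplex ℝ X) (hPpos : ∀ a, 0 < P a)
    (hQpos : ∀ a, 0 < Q a) (hC : 0 < chernoff P Q) :
    ∃ η ∈ Set.Ioo (0 : ℝ) 1, ∀ R ∈ stdSimplex ℝ X,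
      chernoff P Q ≤ η * kl R P + (1 - η) * kl R Q := by
  have hcont : ContinuousOn (fun η => Real.log (chernoffCoeff P Q η)) (Set.Icc 0 1) := by
    refine ContinuousOn.log (continuous_finsetSum _ fun a _ => ?_).continuousOn fun η _ => ?_
    · exact (Real.continuous_const_rpow (hPpos a).ne').mul
        ((Real.continuous_const_rpow (hQpos a).ne').comp (by fun_prop))
    · exact (chernoffCoeff_pos hP.1 hQ.1 η (inter_support_nonempty hP subset_rfl
        fun a _ => (hQpos a).ne')).ne'
  obtain ⟨η, hη, hmin⟩ := isCompact_Icc.exists_sInf_image_eq (Set.nonempty_Icc.2 zero_le_one) hcont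
  have hCη : chernoff P Q = -Real.log (chernoffCoeff P Q η) := congrArg Neg.neg hmin
  refine ⟨η, ⟨hη.1.lt_of_ne' ?_, hη.2.lt_of_ne ?_⟩, fun R hR => hCη ▸ neg_log_chernoffCoeff_le
    hP.1 hQ.1 η hR (fun a _ => (hPpos a).ne') fun a _ => (hQpos a).ne'⟩
  · rintro rfl
    simp [hCη, chernoffCoeff, hQ.2] at hC
  · rintro rfl
    simp [hCη, chernoffCoeff, hP.2] at hC

lemma ne_of_chernoff_pos (hP : P ∈ stdSimplex ℝ X) (hPpos : ∀ a, 0 < P a)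
    (hC : 0 < chernoff P Q) : P ≠ Q := by
  rintro rfl
  obtain ⟨η, -, hη⟩ := exists_chernoff_le hP hP hPpos hPpos hC
  have := hη P hP
  simp only [kl_self, mul_zero, add_zero] at this
  exact this.not_gt hC

lemma neg_two_mul_log_chernoffCoeff_half_lt_kl (hP : P ∈ stdSimplex ℝ X) (hQ : Q ∈ stdSimplex ℝ X)
    (hPpos : ∀ a, 0 < P a) (hQpos : ∀ a, 0 < Q a) (hne : P ≠ Q) :
    -2 * Real.log (chernoffCoeff P Q (1 / 2)) < kl P Q := by
  have hPQ : P.support ⊆ Q.support := fun a _ => (hQpos a).ne'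
  have hQP : Q.support ⊆ P.support := fun a _ => (hPpos a).ne'
  have hP_eq := mul_kl_add_mul_kl hP.1 hQ.1 (1 / 2) hP subset_rfl hPQ
  have hQ_eq := mul_kl_add_mul_kl hP.1 hQ.1 (1 / 2) hQ hQP subset_rfl
  rw [kl_self] at hP_eq hQ_eq
  by_contra! hle
  have hG : P = geoMix P Q (1 / 2) := eq_of_kl_nonpos hP
    (geoMix_mem_stdSimplex hP.1 hQ.1 _ (inter_support_nonempty hP subset_rfl hPQ))
    ((Set.subset_inter subset_rfl hPQ).trans (inter_support_subset_support_geoMix hP.1 hQ.1 _))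
    (by linarith)
  rw [← hG] at hQ_eq
  exact hne (eq_of_kl_nonpos hQ hP hQP (by linarith [kl_nonneg hP hQ hPQ])).symm

end Chernoff

section Reflection

variable {X : Type*} [Fintype X] {P Q M : X → ℝ}

/-- The point `√P` of the unit sphere: the Bhattacharyya coefficient of two distributions is the
inner product of their square roots. -/
noncomputable def sqrtVec (P : X → ℝ) : EuclideanSpace ℝ X := WithLp.toLp 2 fun a => √(P a)

lemma norm_sqrtVec (hP : P ∈ stdSimplex ℝ X) : ‖sqrtVec P‖ = 1 := by
  simp [EuclideanSpace.norm_eq, sqrtVec, Real.sq_sqrt (hP.1 _), hP.2]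

lemma chernoffCoeff_half (P Q : X → ℝ) :
    chernoffCoeff P Q (1 / 2) = inner ℝ (sqrtVec P) (sqrtVec Q) := by
  norm_num [chernoffCoeff, PiLp.inner_apply, sqrtVec, Real.sqrt_eq_rpow, mul_comm]

-- The reflection that swaps `√P` and `√Q` may send `√M` outside the positive orthant; passing to
-- absolute values only increases the two coefficients.
lemma exists_chernoffCoeff_half_ge (hP : P ∈ stdSimplex ℝ X) (hQ : Q ∈ stdSimplex ℝ X)
    (hM : M ∈ stdSimplex ℝ X) :
    ∃ V ∈ stdSimplex ℝ X, chernoffCoeff Q M (1 / 2) ≤ chernoffCoeff P V (1 / 2) ∧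
      chernoffCoeff P M (1 / 2) ≤ chernoffCoeff Q V (1 / 2) := by
  set T := (ℝ ∙ (sqrtVec P - sqrtVec Q))ᗮ.reflection
  have hTP : T (sqrtVec P) = sqrtVec Q :=
    Submodule.reflection_sub ((norm_sqrtVec hP).trans (norm_sqrtVec hQ).symm)
  have hTQ : T (sqrtVec Q) = sqrtVec P := by rw [← hTP, Submodule.reflection_reflection]
  set w := T (sqrtVec M)
  have hw : ∑ a, w a ^ 2 = 1 := by
    rw [← EuclideanSpace.real_norm_sq_eq, LinearIsometryEquiv.norm_map, norm_sqrtVec hM, one_pow]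
  have hinner : ∀ R : X → ℝ, inner ℝ (T (sqrtVec R)) (sqrtVec M) ≤
      chernoffCoeff R (fun a => w a ^ 2) (1 / 2) := fun R => by
    rw [chernoffCoeff_half, ← T.inner_map_map, Submodule.reflection_reflection]
    simp only [PiLp.inner_apply, sqrtVec, Real.sqrt_sq_eq_abs]
    exact Finset.sum_le_sum fun a _ =>
      mul_le_mul_of_nonneg_right (le_abs_self _) (Real.sqrt_nonneg _)
  refine ⟨fun a => w a ^ 2, ⟨fun a => sq_nonneg _, hw⟩, ?_, ?_⟩
  · simpa only [chernoffCoeff_half Q M, hTP] using hinner P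
  · simpa only [chernoffCoeff_half P M, hTQ] using hinner Q

end Reflection

section TypeCost

variable {X : Type*} [Fintype X] {P₁ P₂ : X → ℝ} {α : ℝ}

/-- The exponential rate, per training sample, at which a training sequence from `P₁` and
`1 / α` times as many test samples from `P₂` have the pair of types `Q`; this is the objective
function in `gutmanTradeoff`. -/
noncomputable def typeCost (P₁ P₂ : X → ℝ) (α : ℝ) (Q : (X → ℝ) × (X → ℝ)) : ℝ :=
  kl Q.1 P₁ + kl Q.2 P₂ / α

lemma continuous_typeCost (P₁ P₂ : X → ℝ) (α : ℝ) : Continuous (typeCost P₁ P₂ α) :=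
  ((continuous_kl_left P₁).comp continuous_fst).add
    (((continuous_kl_left P₂).comp continuous_snd).div_const α)

lemma typeCost_nonneg (hP₁ : P₁ ∈ stdSimplex ℝ X) (hP₂ : P₂ ∈ stdSimplex ℝ X)
    (hpos₁ : ∀ a, 0 < P₁ a) (hpos₂ : ∀ a, 0 < P₂ a) (hα : 0 ≤ α) {Q : (X → ℝ) × (X → ℝ)}
    (hQ : Q ∈ stdSimplex ℝ X ×ˢ stdSimplex ℝ X) : 0 ≤ typeCost P₁ P₂ α Q :=
  add_nonneg (kl_nonneg hQ.1 hP₁ fun a _ => (hpos₁ a).ne')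
    (div_nonneg (kl_nonneg hQ.2 hP₂ fun a _ => (hpos₂ a).ne') hα)

lemma neg_two_mul_log_chernoffCoeff_half_lt_gjs (hP₁ : P₁ ∈ stdSimplex ℝ X)
    (hP₂ : P₂ ∈ stdSimplex ℝ X) (hpos₁ : ∀ a, 0 < P₁ a) (hpos₂ : ∀ a, 0 < P₂ a) (hne : P₁ ≠ P₂)
    (hα : 0 < α) :
    -2 * Real.log (chernoffCoeff P₁ (mix P₁ P₂ α) (1 / 2)) +
      -2 * Real.log (chernoffCoeff P₂ (mix P₁ P₂ α) (1 / 2)) / α < gjs P₁ P₂ α / α := by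
  have hmix := mix_mem_stdSimplex hP₁ hP₂ hα.le
  have hmix_pos : ∀ a, 0 < mix P₁ P₂ α a := fun a =>
    (hmix.1 a).lt_of_ne' (support_subset_support_mix_left hP₁.1 hP₂.1 hα (hpos₁ a).ne')
  have h₁ := neg_two_mul_log_chernoffCoeff_half_lt_kl hP₁ hmix hpos₁ hmix_pos
    fun h => hne (eq_of_mix_eq_left hα.le h.symm)
  have h₂ := neg_two_mul_log_chernoffCoeff_half_lt_kl hP₂ hmix hpos₂ hmix_pos
    fun h => hne (eq_of_mix_eq_right hα h.symm)
  calc _ < kl P₁ (mix P₁ P₂ α) + kl P₂ (mix P₁ P₂ α) / α := by gcongr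
    _ = gjs P₁ P₂ α / α := by
      rw [gjs]
      field_simp

lemma exists_typeCost_add_gjs_le {V : X → ℝ} (hP₁ : P₁ ∈ stdSimplex ℝ X)
    (hP₂ : P₂ ∈ stdSimplex ℝ X) (hpos₁ : ∀ a, 0 < P₁ a) (hpos₂ : ∀ a, 0 < P₂ a)
    (hV : V ∈ stdSimplex ℝ X) (hα : 0 < α) :
    ∃ Q ∈ stdSimplex ℝ X ×ˢ stdSimplex ℝ X, typeCost P₁ P₂ α Q + gjs Q.1 Q.2 α / α ≤
      -2 * Real.log (chernoffCoeff P₁ V (1 / 2)) +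
        -2 * Real.log (chernoffCoeff P₂ V (1 / 2)) / α := by
  have hgeo : ∀ {P : X → ℝ}, P ∈ stdSimplex ℝ X → (∀ a, 0 < P a) →
      geoMix P V (1 / 2) ∈ stdSimplex ℝ X ∧ (geoMix P V (1 / 2)).support ⊆ V.support ∧
      kl (geoMix P V (1 / 2)) P + kl (geoMix P V (1 / 2)) V =
        -2 * Real.log (chernoffCoeff P V (1 / 2)) := fun {P} hP hpos => by
    have hmem := geoMix_mem_stdSimplex hP.1 hV.1 (1 / 2)
      (inter_support_nonempty hV (fun a _ => (hpos a).ne') subset_rfl)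
    have hsupp : (geoMix P V (1 / 2)).support ⊆ V.support :=
      Function.support_subset_iff'.2 fun a ha => by
        norm_num [geoMix, Function.notMem_support.1 ha]
    refine ⟨hmem, hsupp, ?_⟩
    have := mul_kl_add_mul_kl hP.1 hV.1 (1 / 2) hmem (fun a _ => (hpos a).ne') hsupp
    rw [kl_self] at this
    linarith
  obtain ⟨hQ₁, hQ₁V, hkl₁⟩ := hgeo hP₁ hpos₁
  obtain ⟨hQ₂, hQ₂V, hkl₂⟩ := hgeo hP₂ hpos₂
  refine ⟨(geoMix P₁ V (1 / 2), geoMix P₂ V (1 / 2)), ⟨hQ₁, hQ₂⟩, ?_⟩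
  have hgjs := div_le_div_of_nonneg_right (gjs_le hQ₁ hQ₂ hα hV hQ₁V hQ₂V) hα.le
  rw [add_div, mul_div_cancel_left₀ _ hα.ne'] at hgjs
  rw [← hkl₁, ← hkl₂, typeCost, add_div]
  linarith

-- In the second case the reflection exchanging `√P₁` and `√P₂` carries the mixture for the
-- exchanged pair `(P₂, P₁)` to a reference vector for `(P₁, P₂)`.
lemma exists_typeCost_add_gjs_lt (hP₁ : P₁ ∈ stdSimplex ℝ X) (hP₂ : P₂ ∈ stdSimplex ℝ X)
    (hpos₁ : ∀ a, 0 < P₁ a) (hpos₂ : ∀ a, 0 < P₂ a) (hne : P₁ ≠ P₂) (hα : 0 < α) {γ : ℝ}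
    (hγ : gjs P₁ P₂ α ≤ γ * α ∨ gjs P₂ P₁ α ≤ γ * α) :
    ∃ Q ∈ stdSimplex ℝ X ×ˢ stdSimplex ℝ X, typeCost P₁ P₂ α Q + gjs Q.1 Q.2 α / α < γ := by
  simp only [← div_le_iff₀ hα] at hγ
  rcases hγ with hγ | hγ
  · obtain ⟨Q, hQ, hle⟩ := exists_typeCost_add_gjs_le hP₁ hP₂ hpos₁ hpos₂
      (mix_mem_stdSimplex hP₁ hP₂ hα.le) hα
    exact ⟨Q, hQ, (hle.trans_lt
      (neg_two_mul_log_chernoffCoeff_half_lt_gjs hP₁ hP₂ hpos₁ hpos₂ hne hα)).trans_le hγ⟩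
  · have hM := mix_mem_stdSimplex hP₂ hP₁ hα.le
    have hM_supp := support_subset_support_mix_right hP₂.1 hP₁.1 hα.le
    obtain ⟨V, hV, h₁, h₂⟩ := exists_chernoffCoeff_half_ge hP₁ hP₂ hM
    obtain ⟨Q, hQ, hle⟩ := exists_typeCost_add_gjs_le hP₁ hP₂ hpos₁ hpos₂ hV hα
    have hlog₁ := Real.log_le_log (chernoffCoeff_pos hP₂.1 hM.1 (1 / 2)
      (inter_support_nonempty hP₁ (fun a _ => (hpos₂ a).ne') hM_supp)) h₁
    have hlog₂ := Real.log_le_log (chernoffCoeff_pos hP₁.1 hM.1 (1 / 2)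
      (inter_support_nonempty hP₁ subset_rfl hM_supp)) h₂
    refine ⟨Q, hQ, hle.trans_lt (lt_of_le_of_lt ?_ ((neg_two_mul_log_chernoffCoeff_half_lt_gjs
      hP₂ hP₁ hpos₂ hpos₁ hne.symm hα).trans_le hγ))⟩
    exact add_le_add (by linarith) (div_le_div_of_nonneg_right (by linarith) hα.le)

end TypeCost

section OptimalThreshold

variable {X : Type*} [Fintype X] {P₁ P₂ : X → ℝ} {α lam : ℝ}

lemma gutmanTradeoff_eq_sInf_image (P₁ P₂ : X → ℝ) (α lam : ℝ) :
    gutmanTradeoff P₁ P₂ α lam = sInf (typeCost P₁ P₂ α ''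
      {Q | Q ∈ stdSimplex ℝ X ×ˢ stdSimplex ℝ X ∧ gjs Q.1 Q.2 α / α ≤ lam}) := by
  rw [gutmanTradeoff]
  congr 1
  ext v
  constructor
  · rintro ⟨Q₁, hQ₁, Q₂, hQ₂, hle, rfl⟩
    exact ⟨(Q₁, Q₂), ⟨⟨hQ₁, hQ₂⟩, hle⟩, rfl⟩
  · rintro ⟨Q, ⟨hQ, hle⟩, rfl⟩
    exact ⟨Q.1, hQ.1, Q.2, hQ.2, hle, rfl⟩

-- At the minimiser of `max (GJS / α) typeCost` with value `v`, any threshold in `(lam, v)` would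
-- have trade-off at least `v` and so beat `lam`.
lemma IsOptimalThreshold.exists_le (hlam : IsOptimalThreshold P₁ P₂ α lam)
    (hP₁ : P₁ ∈ stdSimplex ℝ X) (hα : 0 < α) :
    ∃ Q ∈ stdSimplex ℝ X ×ˢ stdSimplex ℝ X, gjs Q.1 Q.2 α / α ≤ lam ∧ typeCost P₁ P₂ α Q ≤ lam := by
  have hcont : ContinuousOn (fun Q : (X → ℝ) × (X → ℝ) =>
      max (gjs Q.1 Q.2 α / α) (typeCost P₁ P₂ α Q)) (stdSimplex ℝ X ×ˢ stdSimplex ℝ X) :=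
    (((continuousOn_gjs hα).mono fun Q hQ => ⟨hQ.1.1, hQ.2.1⟩).div_const α).sup
      (continuous_typeCost P₁ P₂ α).continuousOn
  obtain ⟨Q, hQ, hmin⟩ := ((isCompact_stdSimplex ℝ X).prod
    (isCompact_stdSimplex ℝ X)).exists_isMinOn ⟨(P₁, P₁), hP₁, hP₁⟩ hcont
  refine ⟨Q, hQ, max_le_iff.1 (le_of_not_gt fun hlt => ?_)⟩
  obtain ⟨l, hlam_lt, hl_lt⟩ := exists_between hlt
  have hF : l ≤ gutmanTradeoff P₁ P₂ α l := by
    rw [gutmanTradeoff_eq_sInf_image]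
    refine le_csInf (Set.Nonempty.image _ ⟨(P₁, P₁), ⟨hP₁, hP₁⟩, ?_⟩) ?_
    · rw [gjs_self P₁ hα.le, zero_div]
      exact hlam.1.trans hlam_lt.le
    · rintro _ ⟨R, ⟨hR, hRl⟩, rfl⟩
      exact ((lt_max_iff.1 (hl_lt.trans_le (hmin hR))).resolve_left hRl.not_gt).le
  have hopt : min l (gutmanTradeoff P₁ P₂ α l) ≤ min lam (gutmanTradeoff P₁ P₂ α lam) :=
    hlam.2 (hlam.1.trans hlam_lt.le)
  rw [min_eq_left hF] at hopt
  exact (hopt.trans (min_le_left _ _)).not_gt hlam_lt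

lemma IsOptimalThreshold.pos (hlam : IsOptimalThreshold P₁ P₂ α lam) (hP₁ : P₁ ∈ stdSimplex ℝ X)
    (hP₂ : P₂ ∈ stdSimplex ℝ X) (hpos₁ : ∀ a, 0 < P₁ a) (hpos₂ : ∀ a, 0 < P₂ a)
    (hne : P₁ ≠ P₂) (hα : 0 < α) : 0 < lam := by
  refine hlam.1.lt_of_ne' fun h₀ => hne ?_
  obtain ⟨⟨Q₁, Q₂⟩, ⟨hQ₁, hQ₂⟩, hgjs, hcost⟩ := hlam.exists_le hP₁ hα
  have hsupp₁ : Q₁.support ⊆ P₁.support := fun a _ => (hpos₁ a).ne'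
  have hsupp₂ : Q₂.support ⊆ P₂.support := fun a _ => (hpos₂ a).ne'
  rw [h₀, typeCost] at hcost
  rw [h₀, div_le_iff₀ hα, zero_mul] at hgjs
  have hkl₁ := kl_nonneg hQ₁ hP₁ hsupp₁
  have hkl₂ := div_nonneg (kl_nonneg hQ₂ hP₂ hsupp₂) hα.le
  rw [← eq_of_kl_nonpos hQ₁ hP₁ hsupp₁ (by linarith), eq_of_gjs_nonpos hQ₁ hQ₂ hα hgjs]
  refine eq_of_kl_nonpos hQ₂ hP₂ hsupp₂ ?_
  simpa using (div_le_iff₀ hα).1 (show kl Q₂ P₂ / α ≤ 0 by linarith)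

lemma IsOptimalThreshold.exists_lt (hlam : IsOptimalThreshold P₁ P₂ α lam)
    (hP₁ : P₁ ∈ stdSimplex ℝ X) (hP₂ : P₂ ∈ stdSimplex ℝ X) (hpos₁ : ∀ a, 0 < P₁ a)
    (hpos₂ : ∀ a, 0 < P₂ a) (hne : P₁ ≠ P₂) (hα : 0 < α) {γ : ℝ}
    (hγ : gjs P₁ P₂ α ≤ γ * α ∨ gjs P₂ P₁ α ≤ γ * α) :
    ∃ Q ∈ stdSimplex ℝ X ×ˢ stdSimplex ℝ X,
      gjs Q.1 Q.2 α / α < lam ∧ typeCost P₁ P₂ α Q < γ := by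
  rcases le_or_gt γ lam with hγlam | hlamγ
  · obtain ⟨Q, hQ, hlt⟩ := exists_typeCost_add_gjs_lt hP₁ hP₂ hpos₁ hpos₂ hne hα hγ
    have hcost := typeCost_nonneg hP₁ hP₂ hpos₁ hpos₂ hα.le hQ
    have hgjs := (kl_mix_left_nonneg hQ.1 hQ.2 hα).trans (kl_mix_left_le hQ.1 hQ.2 hα)
    exact ⟨Q, hQ, by linarith, by linarith⟩
  obtain ⟨⟨Q₁, Q₂⟩, ⟨hQ₁, hQ₂⟩, hgjs, hcost⟩ := hlam.exists_le hP₁ hα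
  let contract (t : ℝ) := AffineMap.lineMap (Q₁, Q₂) (mix Q₁ Q₂ α, mix Q₁ Q₂ α) t
  have hcont : ContinuousAt (fun t : ℝ => typeCost P₁ P₂ α (contract t)) 0 :=
    ((continuous_typeCost P₁ P₂ α).comp AffineMap.lineMap_continuous).continuousAt
  have hcost_lt : ∀ᶠ t in 𝓝[>] (0 : ℝ), typeCost P₁ P₂ α (contract t) < γ :=
    hcont.continuousWithinAt.eventually_lt_const
      (by simpa only [contract, AffineMap.lineMap_apply_zero] using hcost.trans_lt hlamγ)
  obtain ⟨t, htcost, ht₀, ht₁⟩ := (hcost_lt.and (Ioo_mem_nhdsGT one_pos)).exists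
  have hM := mix_mem_stdSimplex hQ₁ hQ₂ hα.le
  refine ⟨contract t, ((convex_stdSimplex ℝ X).prod (convex_stdSimplex ℝ X)).lineMap_mem
    ⟨hQ₁, hQ₂⟩ ⟨hM, hM⟩ ⟨ht₀.le, ht₁.le⟩, ?_, htcost⟩
  have hlam_pos := hlam.pos hP₁ hP₂ hpos₁ hpos₂ hne hα
  calc gjs (contract t).1 (contract t).2 α / α ≤ (1 - t) * gjs Q₁ Q₂ α / α := by
        gcongr
        rw [AffineMap.fst_lineMap, AffineMap.snd_lineMap]
        exact gjs_lineMap_mix_le hQ₁ hQ₂ hα ⟨ht₀.le, ht₁.le⟩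
    _ ≤ (1 - t) * lam := by
        rw [mul_div_assoc]
        exact mul_le_mul_of_nonneg_left hgjs (by linarith)
    _ < lam := by nlinarith

end OptimalThreshold

section MethodOfTypes

variable {X : Type*}

/-- The probability `∏ P(xᵢ)` of a sequence of independent samples of law `P`. -/
def seqProb (P : X → ℝ) {n : ℕ} (x : Fin n → X) : ℝ := ∏ i, P (x i)

lemma seqProb_nonneg {P : X → ℝ} (hP : 0 ≤ P) {n : ℕ} (x : Fin n → X) : 0 ≤ seqProb P x :=
  Finset.prod_nonneg fun i _ => hP (x i)

lemma sum_seqProb [Fintype X] (P : X → ℝ) (n : ℕ) :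
    ∑ x : Fin n → X, seqProb P x = (∑ a, P a) ^ n := by
  classical
  simpa [seqProb] using (Finset.prod_univ_sum (fun _ : Fin n => Finset.univ) fun _ a => P a).symm

variable [DecidableEq X]

lemma empType_nonneg {n : ℕ} (x : Fin n → X) : 0 ≤ empType x := fun _ =>
  div_nonneg (Finset.sum_nonneg fun _ _ => by split_ifs <;> norm_num) (Nat.cast_nonneg n)

/-- The number of occurrences of each letter in a sequence. It determines the type and takes at
most `(n + 1)^|X|` values, which bounds the number of types. -/
def letterCount {n : ℕ} (x : Fin n → X) (a : X) : Fin (n + 1) :=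
  ⟨(Finset.univ.filter fun i => x i = a).card,
    Nat.lt_succ_of_le ((Finset.card_le_univ _).trans_eq (Fintype.card_fin n))⟩

lemma empType_eq_letterCount_div {n : ℕ} (x : Fin n → X) :
    empType x = fun a => ((letterCount x a : ℕ) : ℝ) / n :=
  funext fun a => by simp [empType, letterCount]

lemma support_empType {n : ℕ} (x : Fin n → X) : (empType x).support = Set.range x := by
  ext a
  simp only [empType_eq_letterCount_div, Function.mem_support, ne_eq, div_eq_zero_iff,
    Nat.cast_eq_zero, letterCount, Finset.card_eq_zero, Finset.filter_eq_empty_iff, Set.mem_range]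
  constructor
  · intro h
    by_contra! hne
    exact h (Or.inl fun i _ => hne i)
  · rintro ⟨i, rfl⟩ (h | h)
    exacts [h (Finset.mem_univ i) rfl, i.pos.ne' h]

variable [Fintype X] {P Q : X → ℝ}

lemma sum_comp_eq_mul_sum_empType {n : ℕ} (x : Fin n → X) (f : X → ℝ) :
    ∑ i, f (x i) = n * ∑ a, empType x a * f a := by
  rcases eq_or_ne n 0 with rfl | hn
  · simp
  have hterm : ∀ a, n * (empType x a * f a) = ∑ i, if x i = a then f a else 0 := fun a => by
    rw [empType, ← mul_assoc, mul_div_cancel₀ _ (Nat.cast_ne_zero.2 hn), Finset.sum_mul]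
    simp only [ite_mul, one_mul, zero_mul]
  simp only [Finset.mul_sum, hterm]
  rw [Finset.sum_comm]
  simp

lemma empType_mem_stdSimplex {n : ℕ} (hn : n ≠ 0) (x : Fin n → X) :
    empType x ∈ stdSimplex ℝ X := by
  refine ⟨empType_nonneg x, mul_left_cancel₀ (Nat.cast_ne_zero.2 hn) (b := ∑ a, empType x a) ?_⟩
  simpa using (sum_comp_eq_mul_sum_empType x fun _ => 1).symm

lemma seqProb_eq_mul_exp {n : ℕ} (x : Fin n → X) (hP : ∀ i, 0 < P (x i))
    (hQ : ∀ i, 0 < Q (x i)) :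
    seqProb P x = seqProb Q x * Real.exp (-(n * ∑ a, empType x a * Real.log (Q a / P a))) := by
  rw [← sum_comp_eq_mul_sum_empType x fun a => Real.log (Q a / P a), ← Finset.sum_neg_distrib,
    Real.exp_sum, seqProb, seqProb, ← Finset.prod_mul_distrib]
  refine Finset.prod_congr rfl fun i _ => ?_
  rw [← Real.log_inv, Real.exp_log (inv_pos.2 (div_pos (hQ i) (hP i))), inv_div,
    mul_div_cancel₀ _ (hQ i).ne']

lemma seqProb_eq_mul_exp_kl (hP : 0 ≤ P) {n : ℕ} (x : Fin n → X)
    (hx : (empType x).support ⊆ P.support) :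
    seqProb P x = seqProb (empType x) x * Real.exp (-(n * kl (empType x) P)) := by
  have hmem : ∀ i, x i ∈ (empType x).support := fun i =>
    (support_empType x).symm ▸ Set.mem_range_self i
  exact seqProb_eq_mul_exp x (fun i => (hP _).lt_of_ne' (hx (hmem i)))
    fun i => (empType_nonneg x _).lt_of_ne' (hmem i)

-- Grouping the sequences by type, each of the at most `(n + 1)^|X|` groups has mass at most one
-- under the product law of its common type.
lemma sum_seqProb_empType_le (n : ℕ) :
    ∑ x : Fin n → X, seqProb (empType x) x ≤ ((n : ℝ) + 1) ^ Fintype.card X := by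
  have hfiber : ∀ c : X → Fin (n + 1),
      ∑ x : Fin n → X with letterCount x = c, seqProb (empType x) x ≤ 1 := fun c => by
    let T : X → ℝ := fun a => ((c a : ℕ) : ℝ) / n
    have hT : ∀ x : Fin n → X, letterCount x = c → empType x = T := fun x hx => by
      rw [empType_eq_letterCount_div, hx]
    rcases (Finset.univ.filter fun x : Fin n → X => letterCount x = c).eq_empty_or_nonempty
      with hempty | ⟨y, hy⟩
    · simp [hempty]
    have hTy := hT y (Finset.mem_filter.1 hy).2
    calc ∑ x : Fin n → X with letterCount x = c, seqProb (empType x) x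
        = ∑ x : Fin n → X with letterCount x = c, seqProb T x :=
          Finset.sum_congr rfl fun x hx => by rw [hT x (Finset.mem_filter.1 hx).2]
      _ ≤ ∑ x : Fin n → X, seqProb T x :=
          Finset.sum_le_sum_of_subset_of_nonneg (Finset.filter_subset _ _) fun x _ _ =>
            seqProb_nonneg (hTy ▸ empType_nonneg y) x
      _ = 1 := by
          rcases eq_or_ne n 0 with rfl | hn
          · simp [seqProb]
          · rw [sum_seqProb, ← hTy, (empType_mem_stdSimplex hn y).2, one_pow]
  rw [← Finset.sum_fiberwise Finset.univ (letterCount (X := X) (n := n))]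
  exact (Finset.sum_le_sum fun c _ => hfiber c).trans_eq (by simp)

lemma sum_seqProb_le (hP : 0 ≤ P) {n : ℕ} (A : Finset (Fin n → X)) {κ : ℝ}
    (h : ∀ x ∈ A, (empType x).support ⊆ P.support → κ ≤ n * kl (empType x) P) :
    ∑ x ∈ A, seqProb P x ≤ Real.exp (-κ) * ((n : ℝ) + 1) ^ Fintype.card X := by
  calc ∑ x ∈ A, seqProb P x ≤ ∑ x ∈ A, Real.exp (-κ) * seqProb (empType x) x := by
        refine Finset.sum_le_sum fun x hx => ?_
        have hx₀ := seqProb_nonneg (empType_nonneg x) x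
        by_cases hsupp : (empType x).support ⊆ P.support
        · rw [seqProb_eq_mul_exp_kl hP x hsupp, mul_comm]
          gcongr
          exact h x hx hsupp
        · obtain ⟨_, ⟨i, rfl⟩, hi⟩ := Set.not_subset.1 (support_empType x ▸ hsupp)
          rw [seqProb, Finset.prod_eq_zero (Finset.mem_univ i) (Function.notMem_support.1 hi)]
          positivity
    _ ≤ ∑ x, Real.exp (-κ) * seqProb (empType x) x :=
        Finset.sum_le_sum_of_subset_of_nonneg (Finset.subset_univ A) fun x _ _ =>
          mul_nonneg (Real.exp_nonneg _) (seqProb_nonneg (empType_nonneg x) x)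
    _ ≤ Real.exp (-κ) * ((n : ℝ) + 1) ^ Fintype.card X := by
        rw [← Finset.mul_sum]
        gcongr
        exact sum_seqProb_empType_le n

lemma eventually_pow_le_exp (m : ℕ) {c : ℝ} (hc : 0 < c) :
    ∀ᶠ n : ℕ in atTop, ((n : ℝ) + 1) ^ m ≤ Real.exp (c * n) := by
  have hbound := (isLittleO_pow_exp_pos_mul_atTop m hc).bound (Real.exp_pos (-c))
  have hsucc : Tendsto (fun n : ℕ => (n : ℝ) + 1) atTop atTop :=
    tendsto_atTop_add_const_right _ _ tendsto_natCast_atTop_atTop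
  filter_upwards [hsucc.eventually hbound] with n hn
  rw [Real.norm_of_nonneg (by positivity), Real.norm_of_nonneg (by positivity),
    ← Real.exp_add] at hn
  exact hn.trans_eq (by ring_nf)

lemma eventually_const_le_exp (b : ℝ) {c : ℝ} (hc : 0 < c) :
    ∀ᶠ n : ℕ in atTop, b ≤ Real.exp (c * n) :=
  (Real.tendsto_exp_atTop.comp
    (tendsto_natCast_atTop_atTop.const_mul_atTop hc)).eventually_ge_atTop b

lemma eventually_half_le_sum_seqProb (hQ : Q ∈ stdSimplex ℝ X) {U : Set (X → ℝ)}
    (hU : U ∈ 𝓝[stdSimplex ℝ X] Q) :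
    ∀ᶠ n : ℕ in atTop, ∀ A : Finset (Fin n → X), (∀ x, empType x ∈ U → x ∈ A) →
      1 / 2 ≤ ∑ x ∈ A, seqProb Q x := by
  obtain ⟨ε, hε, hball⟩ := Metric.mem_nhdsWithin_iff.1 hU
  have hc : 0 < ε ^ 2 / 8 := by positivity
  filter_upwards [eventually_pow_le_exp (Fintype.card X) hc, eventually_const_le_exp 2 hc,
    eventually_ne_atTop 0] with n hpow htwo hn A hA
  have hkl : ∀ x ∈ Aᶜ, (empType x).support ⊆ Q.support →
      ε ^ 2 / 8 * n + ε ^ 2 / 8 * n ≤ n * kl (empType x) Q := fun x hx hsupp => by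
    have hmem := empType_mem_stdSimplex hn x
    have hdist : ε ≤ dist (empType x) Q := not_lt.1 fun hlt =>
      Finset.mem_compl.1 hx (hA x (hball ⟨hlt, hmem⟩))
    have hsq := (Real.le_sqrt' hε).1 (hdist.trans (dist_le_sqrt_kl hmem hQ hsupp))
    nlinarith [Nat.cast_nonneg (α := ℝ) n]
  have hcompl : ∑ x ∈ Aᶜ, seqProb Q x ≤ 1 / 2 :=
    calc ∑ x ∈ Aᶜ, seqProb Q x
        ≤ Real.exp (-(ε ^ 2 / 8 * n + ε ^ 2 / 8 * n)) * ((n : ℝ) + 1) ^ Fintype.card X :=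
          sum_seqProb_le hQ.1 Aᶜ hkl
      _ ≤ Real.exp (-(ε ^ 2 / 8 * n + ε ^ 2 / 8 * n)) * Real.exp (ε ^ 2 / 8 * n) := by gcongr
      _ = (Real.exp (ε ^ 2 / 8 * n))⁻¹ := by
          rw [← Real.exp_add, ← Real.exp_neg]
          ring_nf
      _ ≤ 1 / 2 := by
          rw [one_div]
          gcongr
  have htotal := Finset.sum_add_sum_compl A (seqProb Q)
  rw [sum_seqProb, hQ.2, one_pow] at htotal
  linarith

lemma eventually_exp_le_sum_seqProb (hP : ∀ a, 0 < P a) (hQ : Q ∈ stdSimplex ℝ X)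
    {U : Set (X → ℝ)} (hU : U ∈ 𝓝[stdSimplex ℝ X] Q) {d : ℝ} (hd : kl Q P < d) :
    ∀ᶠ n : ℕ in atTop, ∀ A : Finset (Fin n → X), (∀ x, empType x ∈ U → x ∈ A) →
      Real.exp (-(d * n)) ≤ ∑ x ∈ A, seqProb P x := by
  classical
  obtain ⟨c, hklc, hcd⟩ := exists_between hd
  let L (T : X → ℝ) : ℝ := ∑ a, T a * Real.log (Q a / P a)
  have hL : {T | L T < c} ∈ 𝓝[stdSimplex ℝ X] Q := mem_nhdsWithin_of_mem_nhds
    ((isOpen_lt (f := L) (by fun_prop) continuous_const).mem_nhds hklc)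
  filter_upwards [eventually_half_le_sum_seqProb hQ (inter_mem hU hL),
    eventually_const_le_exp 2 (sub_pos.2 hcd)] with n hhalf htwo A hA
  have hterm : ∀ x : Fin n → X, L (empType x) < c →
      seqProb Q x * Real.exp (-(c * n)) ≤ seqProb P x := fun x hx => by
    have hx₀ := seqProb_nonneg hQ.1 x
    rcases hx₀.eq_or_lt' with hzero | hpos
    · rw [hzero, zero_mul]
      exact seqProb_nonneg (fun a => (hP a).le) x
    · rw [seqProb_eq_mul_exp x (fun i => hP _) fun i =>
        (hQ.1 _).lt_of_ne' (Finset.prod_ne_zero_iff.1 hpos.ne' i (Finset.mem_univ i)), mul_comm c]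
      gcongr
  calc Real.exp (-(d * n)) = (Real.exp ((d - c) * n))⁻¹ * Real.exp (-(c * n)) := by
        rw [← Real.exp_neg, ← Real.exp_add]
        ring_nf
    _ ≤ 1 / 2 * Real.exp (-(c * n)) := by
        rw [one_div]
        gcongr
    _ ≤ (∑ x with empType x ∈ U ∩ {T | L T < c}, seqProb Q x) * Real.exp (-(c * n)) := by
        gcongr
        exact hhalf _ fun x hx => by simpa using hx
    _ ≤ ∑ x with empType x ∈ U ∩ {T | L T < c}, seqProb P x := by
        rw [Finset.sum_mul]
        exact Finset.sum_le_sum fun x hx => hterm x (Finset.mem_filter.1 hx).2.2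
    _ ≤ ∑ x ∈ A, seqProb P x :=
        Finset.sum_le_sum_of_subset_of_nonneg (fun x hx => hA x (Finset.mem_filter.1 hx).2.1)
          fun x _ _ => seqProb_nonneg (fun a => (hP a).le) x

end MethodOfTypes

section PairProb

variable {X : Type*} {P P₁ P₂ Q : X → ℝ}

/-- The probability that a training sequence from `P` and a test sequence from `Q`, independent of
each other, form a pair in `A`. -/
def pairProb (P Q : X → ℝ) {N n : ℕ} (A : Finset ((Fin N → X) × (Fin n → X))) : ℝ :=
  ∑ z ∈ A, seqProb P z.1 * seqProb Q z.2

lemma pairProb_product {N n : ℕ} (A : Finset (Fin N → X)) (B : Finset (Fin n → X)) :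
    pairProb P Q (A ×ˢ B) = (∑ x ∈ A, seqProb P x) * ∑ y ∈ B, seqProb Q y := by
  rw [pairProb, Finset.sum_mul_sum, Finset.sum_product]

lemma pairProb_mono (hP : 0 ≤ P) (hQ : 0 ≤ Q) {N n : ℕ}
    {A B : Finset ((Fin N → X) × (Fin n → X))} (h : A ⊆ B) : pairProb P Q A ≤ pairProb P Q B :=
  Finset.sum_le_sum_of_subset_of_nonneg h fun z _ _ =>
    mul_nonneg (seqProb_nonneg hP z.1) (seqProb_nonneg hQ z.2)

variable [Fintype X] [DecidableEq X]

lemma pairProb_le (hP : ∀ a, 0 < P a) (hQ : ∀ a, 0 < Q a) {N n : ℕ} (hN : N ≠ 0)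
    (A : Finset ((Fin N → X) × (Fin n → X))) {κ : ℝ}
    (h : ∀ z ∈ A, κ ≤ typeCost P Q ((N : ℝ) / n) (empType z.1, empType z.2)) :
    pairProb P Q A ≤ Real.exp (-(κ * N)) *
      (((N : ℝ) + 1) ^ Fintype.card X * ((n : ℝ) + 1) ^ Fintype.card X) := by
  let w (z : (Fin N → X) × (Fin n → X)) : ℝ :=
    seqProb (empType z.1) z.1 * seqProb (empType z.2) z.2
  have hw : ∀ z, 0 ≤ w z := fun z =>
    mul_nonneg (seqProb_nonneg (empType_nonneg _) _) (seqProb_nonneg (empType_nonneg _) _)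
  have hterm : ∀ z : (Fin N → X) × (Fin n → X), seqProb P z.1 * seqProb Q z.2 =
      Real.exp (-(typeCost P Q ((N : ℝ) / n) (empType z.1, empType z.2) * N)) * w z := fun z => by
    have hcost : typeCost P Q ((N : ℝ) / n) (empType z.1, empType z.2) * N =
        N * kl (empType z.1) P + n * kl (empType z.2) Q := by
      rw [typeCost, div_div_eq_mul_div]
      field_simp
    rw [seqProb_eq_mul_exp_kl (fun a => (hP a).le) z.1 fun a _ => (hP a).ne',
      seqProb_eq_mul_exp_kl (fun a => (hQ a).le) z.2 fun a _ => (hQ a).ne', hcost, neg_add,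
      Real.exp_add]
    ring
  calc pairProb P Q A ≤ ∑ z ∈ A, Real.exp (-(κ * N)) * w z := by
        refine Finset.sum_le_sum fun z hz => ?_
        rw [hterm]
        gcongr
        exacts [hw z, h z hz]
    _ ≤ Real.exp (-(κ * N)) * ∑ z, w z := by
        rw [← Finset.mul_sum]
        gcongr
        exacts [fun z _ _ => hw z, Finset.subset_univ A]
    _ = Real.exp (-(κ * N)) * ((∑ x : Fin N → X, seqProb (empType x) x) *
          ∑ y : Fin n → X, seqProb (empType y) y) := by
        rw [Finset.sum_mul_sum, Fintype.sum_prod_type]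
    _ ≤ _ := by
        gcongr
        · exact Finset.sum_nonneg fun y _ => seqProb_nonneg (empType_nonneg y) y
        · exact sum_seqProb_empType_le N
        · exact sum_seqProb_empType_le n

lemma tendsto_atTop_of_tendsto_div {n : ℕ → ℕ} {α : ℝ} (hα : 0 < α)
    (hn : Tendsto (fun N : ℕ => (N : ℝ) / n N) atTop (𝓝 α)) : Tendsto n atTop atTop := by
  have hinv : Tendsto (fun N : ℕ => ((N : ℝ) / n N)⁻¹ * N) atTop atTop :=
    (hn.inv₀ hα.ne').pos_mul_atTop (inv_pos.2 hα) tendsto_natCast_atTop_atTop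
  refine tendsto_natCast_atTop_iff.1 (hinv.congr' ?_)
  filter_upwards [eventually_ne_atTop 0] with N hN
  rw [inv_div, div_mul_cancel₀ _ (Nat.cast_ne_zero.2 hN)]

lemma exists_gt_exists_gt_add_div_lt {a b α d : ℝ} (hα : 0 < α) (h : a + b / α < d) :
    ∃ a' > a, ∃ b' > b, a' + b' / α < d := by
  obtain ⟨a', ha', had⟩ := exists_between (lt_sub_iff_add_lt.2 h)
  obtain ⟨b', hb', hbd⟩ := exists_between ((div_lt_iff₀ hα).1 (lt_sub_comm.1 had))
  exact ⟨a', ha', b', hb', lt_sub_iff_add_lt'.1 ((div_lt_iff₀ hα).2 hbd)⟩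

lemma eventually_exp_le_pairProb (hP₁ : ∀ a, 0 < P₁ a) (hP₂ : ∀ a, 0 < P₂ a) {α : ℝ} (hα : 0 < α)
    {n : ℕ → ℕ} (hn : Tendsto (fun N : ℕ => (N : ℝ) / n N) atTop (𝓝 α)) {T : (X → ℝ) × (X → ℝ)}
    (hT : T ∈ stdSimplex ℝ X ×ˢ stdSimplex ℝ X) {U : Set ((X → ℝ) × (X → ℝ))}
    (hU : U ∈ 𝓝[stdSimplex ℝ X ×ˢ stdSimplex ℝ X] T) {d : ℝ} (hd : typeCost P₁ P₂ α T < d) :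
    ∀ᶠ N : ℕ in atTop, ∀ A : Finset ((Fin N → X) × (Fin (n N) → X)),
      (∀ z, (empType z.1, empType z.2) ∈ U → z ∈ A) →
        Real.exp (-(d * N)) ≤ pairProb P₁ P₂ A := by
  classical
  obtain ⟨U₁, hU₁, U₂, hU₂, hsub⟩ := mem_nhdsWithin_prod_iff.1 hU
  obtain ⟨d₁, hd₁, d₂, hd₂, hrate⟩ := exists_gt_exists_gt_add_div_lt hα hd
  have hlim : Tendsto (fun N : ℕ => d₁ + d₂ / ((N : ℝ) / n N)) atTop (𝓝 (d₁ + d₂ / α)) :=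
    (tendsto_const_nhds.div hn hα.ne').const_add d₁
  filter_upwards [eventually_exp_le_sum_seqProb hP₁ hT.1 hU₁ hd₁,
    (tendsto_atTop_of_tendsto_div hα hn).eventually
      (eventually_exp_le_sum_seqProb hP₂ hT.2 hU₂ hd₂),
    hlim.eventually_lt_const hrate, eventually_gt_atTop 0] with N htrain htest hlt hN A hA
  have : (0 : ℝ) < N := Nat.cast_pos.2 hN
  calc Real.exp (-(d * N))
      ≤ Real.exp (-(d₁ * N)) * Real.exp (-(d₂ * n N)) := by
        rw [← Real.exp_add, Real.exp_le_exp, ← neg_add, neg_le_neg_iff]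
        calc d₁ * N + d₂ * n N = (d₁ + d₂ / ((N : ℝ) / n N)) * N := by
              rw [div_div_eq_mul_div]
              field_simp
          _ ≤ d * N := by gcongr
    _ ≤ (∑ x with empType x ∈ U₁, seqProb P₁ x) * ∑ y with empType y ∈ U₂, seqProb P₂ y := by
        refine mul_le_mul (htrain _ fun x hx => ?_) (htest _ fun y hy => ?_) (Real.exp_nonneg _)
          (Finset.sum_nonneg fun x _ => seqProb_nonneg (fun a => (hP₁ a).le) x)
        exacts [Finset.mem_filter.2 ⟨Finset.mem_univ x, hx⟩,
          Finset.mem_filter.2 ⟨Finset.mem_univ y, hy⟩]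
    _ ≤ pairProb P₁ P₂ A := by
        rw [← pairProb_product]
        refine pairProb_mono (fun a => (hP₁ a).le) (fun a => (hP₂ a).le) fun z hz => hA z (hsub ?_)
        simpa using hz

end PairProb

section Law

variable {X : Type*}

lemma vec_nonneg (P : PMF X) (a : X) : 0 ≤ vec P a :=
  ENNReal.toReal_nonneg

lemma vec_mem_stdSimplex [Fintype X] (P : PMF X) : vec P ∈ stdSimplex ℝ X := by
  refine ⟨vec_nonneg P, ?_⟩
  simp only [vec]
  rw [← ENNReal.toReal_sum fun a _ => P.apply_ne_top a, ← tsum_fintype (L := .unconditional X),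
    P.tsum_coe, ENNReal.toReal_one]

lemma vec_pos {P : PMF X} (hP : ∀ a, P a ≠ 0) (a : X) : 0 < vec P a :=
  ENNReal.toReal_pos (hP a) (P.apply_ne_top a)

lemma source_ne_zero {P₁ P₂ : PMF X} (hP₁ : ∀ a, P₁ a ≠ 0) (hP₂ : ∀ a, P₂ a ≠ 0) (i : Hyp)
    (a : X) : source P₁ P₂ i a ≠ 0 := by
  cases i
  exacts [hP₁ a, hP₂ a]

variable [MeasurableSpace X]

lemma measurePreserving_prefix (P : PMF X) (n : ℕ) :
    MeasurePreserving (fun (y : ℕ → X) (k : Fin n) => y k)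
      (Measure.infinitePi fun _ => P.toMeasure) (Measure.pi fun _ => P.toMeasure) :=
  ⟨by fun_prop, by
    rw [← Measure.infinitePi_eq_pi]
    exact Measure.map_infinitePi_infinitePi_of_inj Fin.val_injective⟩

lemma measurePreserving_train_prefix (P₁ P₂ : PMF X) (N n : ℕ) (i j : Hyp) :
    MeasurePreserving
      (fun s : (Fin N → X) × (Fin N → X) × (ℕ → X) => ((toData s).train i, (toData s).prefix n))
      (law P₁ P₂ N j)
      ((Measure.pi fun _ => (source P₁ P₂ i).toMeasure).prod
        (Measure.pi fun _ => (source P₁ P₂ j).toMeasure)) := by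
  have hprefix := measurePreserving_prefix (source P₁ P₂ j) n
  cases i with
  | H₁ => exact (MeasurePreserving.id _).prod (hprefix.comp measurePreserving_snd)
  | H₂ => exact ((MeasurePreserving.id _).prod hprefix).comp measurePreserving_snd

variable [MeasurableSingletonClass X]

lemma pi_toMeasure_singleton (P : PMF X) {n : ℕ} (x : Fin n → X) :
    (Measure.pi fun _ => P.toMeasure) {x} = ENNReal.ofReal (seqProb (vec P) x) := by
  rw [Measure.pi_singleton, seqProb,
    ENNReal.ofReal_prod_of_nonneg fun k _ => vec_nonneg P (x k)]
  refine Finset.prod_congr rfl fun k _ => ?_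
  rw [P.toMeasure_apply_singleton _ (measurableSet_singleton _), vec,
    ENNReal.ofReal_toReal (P.apply_ne_top _)]

lemma law_train_prefix_mem (P₁ P₂ : PMF X) {N n : ℕ} (i j : Hyp)
    (A : Finset ((Fin N → X) × (Fin n → X))) :
    law P₁ P₂ N j {s | ((toData s).train i, (toData s).prefix n) ∈ A} =
      ENNReal.ofReal (pairProb (vec (source P₁ P₂ i)) (vec (source P₁ P₂ j)) A) := by
  have hvec : ∀ (k : Hyp) {m : ℕ} (x : Fin m → X), 0 ≤ seqProb (vec (source P₁ P₂ k)) x :=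
    fun k _ x => seqProb_nonneg (vec_nonneg _) x
  refine ((measurePreserving_train_prefix P₁ P₂ N n i j).measure_preimage
    A.measurableSet.nullMeasurableSet).trans ?_
  rw [← sum_measure_singleton, pairProb,
    ENNReal.ofReal_sum_of_nonneg fun z _ => mul_nonneg (hvec i z.1) (hvec j z.2)]
  refine Finset.sum_congr rfl fun z _ => ?_
  rw [← Set.singleton_prod_singleton, Measure.prod_prod, pi_toMeasure_singleton,
    pi_toMeasure_singleton, ENNReal.ofReal_mul (hvec i z.1)]

end Law

section ErrorExponent

lemma le_neg_log_div_iff {x : ENNReal} {d : ℝ} {N : ℕ} (hN : N ≠ 0) :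
    (d : EReal) ≤ -ENNReal.log x / (N : EReal) ↔ x ≤ ENNReal.ofReal (Real.exp (-(d * N))) := by
  rw [EReal.le_div_iff_mul_le (mod_cast Nat.pos_of_ne_zero hN) (EReal.natCast_ne_top N),
    EReal.le_neg, ← ENNReal.log_le_log_iff, ENNReal.log_ofReal_of_pos (Real.exp_pos _),
    Real.log_exp]
  norm_cast

lemma neg_log_div_le_iff {x : ENNReal} {d : ℝ} {N : ℕ} (hN : N ≠ 0) :
    -ENNReal.log x / (N : EReal) ≤ d ↔ ENNReal.ofReal (Real.exp (-(d * N))) ≤ x := by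
  rw [EReal.div_le_iff_le_mul (mod_cast Nat.pos_of_ne_zero hN) (EReal.natCast_ne_top N),
    EReal.neg_le, ← ENNReal.log_le_log_iff, ENNReal.log_ofReal_of_pos (Real.exp_pos _),
    Real.log_exp, mul_comm]
  norm_cast

variable {X : Type*} [MeasurableSpace X] {P₁ P₂ : PMF X} {p : ℝ}

lemma bayesErr_le (hp : p ∈ Set.Icc (0 : ℝ) 1) {N : ℕ} {Φ : Test X N} {c : ENNReal}
    (h : ∀ i, errProb P₁ P₂ Φ i ≤ c) : bayesErr P₁ P₂ p Φ ≤ c :=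
  calc bayesErr P₁ P₂ p Φ ≤ ENNReal.ofReal p * c + ENNReal.ofReal (1 - p) * c := by
        rw [bayesErr]
        gcongr
        exacts [h .H₁, h .H₂]
    _ = c := by
        rw [← add_mul, ← ENNReal.ofReal_add hp.1 (sub_nonneg.2 hp.2), add_sub_cancel,
          ENNReal.ofReal_one, one_mul]

lemma le_bayesExponent (hp : p ∈ Set.Icc (0 : ℝ) 1) {Φ : ∀ N, Test X N} {γ : ℝ}
    (h : ∀ d < γ, ∀ i, ∀ᶠ N : ℕ in atTop,
      errProb P₁ P₂ (Φ N) i ≤ ENNReal.ofReal (Real.exp (-(d * N)))) :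
    (γ : EReal) ≤ bayesExponent P₁ P₂ p Φ := by
  refine EReal.ge_of_forall_gt_iff_ge.1 fun d hd => le_liminf_of_le (by isBoundedDefault) ?_
  have hdγ := EReal.coe_lt_coe_iff.1 hd
  filter_upwards [h d hdγ .H₁, h d hdγ .H₂, eventually_ne_atTop 0] with N h₁ h₂ hN
  exact (le_neg_log_div_iff hN).2 (bayesErr_le hp fun i => by cases i <;> assumption)

lemma bayesExponent_le (hp : p < 1) {Φ : ∀ N, Test X N} {d : ℝ}
    (h : ∀ᶠ N : ℕ in atTop, ENNReal.ofReal (Real.exp (-(d * N))) ≤ errProb P₁ P₂ (Φ N) .H₂) :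
    bayesExponent P₁ P₂ p Φ ≤ d := by
  refine EReal.le_of_forall_lt_iff_le.1 fun c hc =>
    liminf_le_of_frequently_le (Eventually.frequently ?_) (by isBoundedDefault)
  filter_upwards [h, eventually_const_le_exp (1 - p)⁻¹ (sub_pos.2 (EReal.coe_lt_coe_iff.1 hc)),
    eventually_ne_atTop 0] with N herr hprior hN
  have hp' : 0 < 1 - p := sub_pos.2 hp
  refine (neg_log_div_le_iff hN).2 ?_
  calc ENNReal.ofReal (Real.exp (-(c * N)))
      = ENNReal.ofReal ((Real.exp ((c - d) * N))⁻¹ * Real.exp (-(d * N))) := by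
        rw [← Real.exp_neg, ← Real.exp_add]
        ring_nf
    _ ≤ ENNReal.ofReal ((1 - p) * Real.exp (-(d * N))) := by
        gcongr
        exact inv_le_of_inv_le₀ hp' hprior
    _ = ENNReal.ofReal (1 - p) * ENNReal.ofReal (Real.exp (-(d * N))) :=
        ENNReal.ofReal_mul hp'.le
    _ ≤ bayesErr P₁ P₂ p (Φ N) := le_add_left (by gcongr)

end ErrorExponent

section SequentialTest

variable {X : Type*} [Fintype X]

lemma chernoff_comm (P Q : X → ℝ) : chernoff P Q = chernoff Q P := by
  have hreflect : (fun η : ℝ => Real.log (∑ a, P a ^ η * Q a ^ (1 - η))) =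
      (fun η : ℝ => Real.log (∑ a, Q a ^ η * P a ^ (1 - η))) ∘ fun η => 1 - η :=
    funext fun η => by simp only [Function.comp_apply, sub_sub_cancel, mul_comm]
  rw [chernoff, chernoff, hreflect, Set.image_comp, Set.image_const_sub_Icc, sub_self, sub_zero]

lemma gjs_le_mul_typeCost {P : X → ℝ} (hP : P ∈ stdSimplex ℝ X) (hpos : ∀ a, 0 < P a) {α : ℝ}
    (hα : 0 < α) {Q : (X → ℝ) × (X → ℝ)} (hQ : Q ∈ stdSimplex ℝ X ×ˢ stdSimplex ℝ X) :
    gjs Q.1 Q.2 α ≤ α * typeCost P P α Q := by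
  rw [typeCost, mul_add, mul_div_cancel₀ _ hα.ne']
  exact gjs_le hQ.1 hQ.2 hα hP (fun a _ => (hpos a).ne') fun a _ => (hpos a).ne'

lemma eventually_kl_sub_kl_le {P : X → ℝ} (hpos : ∀ a, 0 < P a) {c : ℝ} (hc : 0 < c) :
    ∀ᶠ M in 𝓝 P, ∀ Q ∈ stdSimplex ℝ X, Q.support ⊆ M.support → kl Q P ≤ kl Q M + c := by
  have hlog : ∀ᶠ M in 𝓝 P, ∀ a, Real.log (M a / P a) < c := eventually_all.2 fun a => by
    have hcont : ContinuousAt (fun M : X → ℝ => Real.log (M a / P a)) P :=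
      ((continuous_apply a).continuousAt.div_const _).log (div_pos (hpos a) (hpos a)).ne'
    exact hcont.eventually_lt_const (by simpa [(hpos a).ne'] using hc)
  filter_upwards [hlog] with M hM Q hQ hsupp
  calc kl Q P = kl Q M + ∑ a, Q a * Real.log (M a / P a) :=
        kl_eq_kl_add (fun a _ => (hpos a).ne') hsupp
    _ ≤ kl Q M + ∑ a, Q a * c := by
        gcongr with a
        exacts [hQ.1 a, (hM a).le]
    _ = kl Q M + c := by rw [← Finset.sum_mul, hQ.2, one_mul]

lemma eventually_sub_le_typeCost {P P' : X → ℝ} (hP : P ∈ stdSimplex ℝ X)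
    (hP' : P' ∈ stdSimplex ℝ X) (hpos : ∀ a, 0 < P a) (hpos' : ∀ a, 0 < P' a) {γ ε : ℝ}
    (hγ : γ ∈ Set.Ioc 0 (chernoff P P')) (hε : 0 < ε) :
    ∀ᶠ α in 𝓝[>] (0 : ℝ), ∀ Q ∈ stdSimplex ℝ X ×ˢ stdSimplex ℝ X,
      gjs Q.1 Q.2 α < γ * α → γ - ε ≤ typeCost P' P α Q := by
  obtain ⟨η, hη, hchernoff⟩ := exists_chernoff_le hP hP' hpos hpos' (hγ.1.trans_le hγ.2)
  have hη' : 0 < 1 - η := sub_pos.2 hη.2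
  obtain ⟨r, hr, hball⟩ :=
    Metric.eventually_nhds_iff.1 (eventually_kl_sub_kl_le hpos (mul_pos hη' hε))
  have hsmall : ∀ᶠ α in 𝓝[>] (0 : ℝ), α + √(4 * (γ * α)) < r := by
    have hcont : Continuous fun α : ℝ => α + √(4 * (γ * α)) := by fun_prop
    exact hcont.continuousWithinAt.eventually_lt_const (by simpa using hr)
  filter_upwards [hsmall, self_mem_nhdsWithin] with α hsmall hα ⟨Q, R⟩ ⟨hQ, hR⟩ hlt
  have hα : 0 < α := hα
  have hklQ : 0 ≤ kl Q P' := kl_nonneg hQ hP' fun a _ => (hpos' a).ne'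
  have hklR : 0 ≤ kl R P := kl_nonneg hR hP fun a _ => (hpos a).ne'
  rcases le_or_gt (γ * α) (kl R P) with hfar | hnear
  · have : γ ≤ kl R P / α := (le_div_iff₀ hα).2 hfar
    rw [typeCost]
    linarith
  have hmix : dist (mix Q R α) P < r :=
    calc dist (mix Q R α) P ≤ dist (mix Q R α) R + dist R P := dist_triangle _ _ _
      _ ≤ α + √(4 * (γ * α)) := by
        gcongr
        · exact dist_mix_right_le hQ hR hα.le
        · exact (dist_le_sqrt_kl hR hP fun a _ => (hpos a).ne').trans (by gcongr)
      _ < r := hsmall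
  have hklmix : kl Q (mix Q R α) < γ :=
    (kl_mix_left_le hQ hR hα).trans_lt ((div_lt_iff₀ hα).2 hlt)
  have hkl := hball hmix Q hQ (support_subset_support_mix_left hQ.1 hR.1 hα)
  have hγη : (1 - η) * (γ - η * ε) ≤ (1 - η) * kl Q P' := by
    nlinarith [hchernoff Q hQ, hγ.2, hη.1]
  have hγkl : γ - η * ε ≤ kl Q P' := le_of_mul_le_mul_left hγη hη'
  have : 0 ≤ kl R P / α := div_nonneg hklR hα.le
  have : η * ε ≤ ε := mul_le_of_le_one_left hε.le hη.2.le
  rw [typeCost]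
  linarith

variable [DecidableEq X] {N : ℕ} {γ : ℝ}

lemma seqTime_eq_or_exists_le_score (γ : ℝ) (ω : Data X N) :
    seqTime γ ω = N ^ 2 ∨ 1 ≤ seqTime γ ω ∧ ∃ i, γ * N ≤ score i (seqTime γ ω) ω :=
  (Nat.sInf_mem (s := {n | 1 ≤ n ∧ ∃ i, γ * N ≤ score i n ω} ∪ {N ^ 2})
    ⟨N ^ 2, Or.inr rfl⟩).symm

lemma seqTime_mem_Icc (hN : N ≠ 0) (γ : ℝ) (ω : Data X N) :
    seqTime γ ω ∈ Finset.Icc 1 (N ^ 2) := by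
  refine Finset.mem_Icc.2 ⟨?_, Nat.sInf_le (Or.inr rfl)⟩
  rcases seqTime_eq_or_exists_le_score γ ω with htime | ⟨hone, -⟩
  exacts [htime ▸ Nat.one_le_pow _ _ (Nat.pos_of_ne_zero hN), hone]

lemma IsSeqTest.exists_le_score_or_score_lt (hN : N ≠ 0) {Φ : Test X N} (h : IsSeqTest γ Φ)
    {i j : Hyp} (hij : i ≠ j) {ω : Data X N} (hd : Φ.d ω ≠ i) :
    (∃ n ∈ Finset.Icc 1 (N ^ 2), γ * N ≤ score i n ω) ∨ score j (N ^ 2) ω < γ * N := by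
  obtain ⟨hT, hd₁, hd₂⟩ := h ω
  rw [hT] at hd₁ hd₂
  rcases le_or_gt (γ * N) (score i (seqTime γ ω) ω) with hi | hi
  · exact Or.inl ⟨_, seqTime_mem_Icc hN γ ω, hi⟩
  have hj : score j (seqTime γ ω) ω < γ * N := by
    by_contra! hj
    cases i <;> cases j
    exacts [hij rfl, hd (hd₁ hj hi), hd (hd₂ hj hi), hij rfl]
  rcases seqTime_eq_or_exists_le_score γ ω with htime | ⟨-, k, hk⟩
  · exact Or.inr (htime ▸ hj)
  · cases i <;> cases j <;> cases k <;> first | exact absurd rfl hij | linarith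

variable [MeasurableSpace X] {P₁ P₂ : PMF X}

lemma IsSeqTest.errProb_le (hN : N ≠ 0) {Φ : Test X N} (h : IsSeqTest γ Φ) {i j : Hyp}
    (hij : i ≠ j) : errProb P₁ P₂ Φ i ≤
      ∑ n ∈ Finset.Icc 1 (N ^ 2), law P₁ P₂ N i {s | γ * N ≤ score i n (toData s)} +
        law P₁ P₂ N i {s | score j (N ^ 2) (toData s) < γ * N} := by
  have hsub : {s | Φ.d (toData s) ≠ i} ⊆
      (⋃ n ∈ Finset.Icc 1 (N ^ 2), {s | γ * N ≤ score i n (toData s)}) ∪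
        {s | score j (N ^ 2) (toData s) < γ * N} := fun s hs => by
    rcases h.exists_le_score_or_score_lt hN hij hs with ⟨n, hn, hscore⟩ | hscore
    exacts [Or.inl (Set.mem_biUnion hn hscore), Or.inr hscore]
  calc errProb P₁ P₂ Φ i ≤ _ := measure_mono hsub
    _ ≤ _ := measure_union_le _ _
    _ ≤ _ := by
        gcongr
        exact measure_biUnion_finset_le _ _

variable [MeasurableSingletonClass X]

lemma law_empType_mem_le (hP₁ : ∀ a, P₁ a ≠ 0) (hP₂ : ∀ a, P₂ a ≠ 0) (hN : N ≠ 0) {n : ℕ}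
    (hn : n ∈ Finset.Icc 1 (N ^ 2)) (i j : Hyp) (U : Set ((X → ℝ) × (X → ℝ))) {κ : ℝ}
    (hκ : ∀ Q ∈ stdSimplex ℝ X ×ˢ stdSimplex ℝ X, Q ∈ U →
      κ ≤ typeCost (vec (source P₁ P₂ i)) (vec (source P₁ P₂ j)) ((N : ℝ) / n) Q) :
    law P₁ P₂ N j {s | (empType ((toData s).train i), empType ((toData s).prefix n)) ∈ U} ≤
      ENNReal.ofReal (Real.exp (-(κ * N)) * ((N : ℝ) + 1) ^ (3 * Fintype.card X)) := by
  classical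
  obtain ⟨hn₁, hnN⟩ := Finset.mem_Icc.1 hn
  let A : Finset ((Fin N → X) × (Fin n → X)) := {z | (empType z.1, empType z.2) ∈ U}
  have hA : ∀ z, z ∈ A ↔ (empType z.1, empType z.2) ∈ U := fun z =>
    Finset.mem_filter_univ z
  have hn' : (n : ℝ) + 1 ≤ ((N : ℝ) + 1) ^ 2 := by
    have : (n : ℝ) ≤ (N : ℝ) ^ 2 := mod_cast hnN
    nlinarith [Nat.cast_nonneg (α := ℝ) N]
  have hset : {s : (Fin N → X) × (Fin N → X) × (ℕ → X) |
      (empType ((toData s).train i), empType ((toData s).prefix n)) ∈ U} =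
      {s | ((toData s).train i, (toData s).prefix n) ∈ A} :=
    Set.ext fun s => (hA ((toData s).train i, (toData s).prefix n)).symm
  rw [hset, law_train_prefix_mem]
  refine ENNReal.ofReal_le_ofReal ((pairProb_le (vec_pos (source_ne_zero hP₁ hP₂ i))
    (vec_pos (source_ne_zero hP₁ hP₂ j)) hN A fun z hz => hκ _
      ⟨empType_mem_stdSimplex hN _, empType_mem_stdSimplex (by lia) _⟩ ((hA z).1 hz)).trans ?_)
  gcongr
  calc ((N : ℝ) + 1) ^ Fintype.card X * ((n : ℝ) + 1) ^ Fintype.card X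
      ≤ ((N : ℝ) + 1) ^ Fintype.card X * (((N : ℝ) + 1) ^ 2) ^ Fintype.card X := by gcongr
    _ = ((N : ℝ) + 1) ^ (3 * Fintype.card X) := by
        rw [← pow_mul, ← pow_add]
        ring_nf

lemma law_le_score_le (hP₁ : ∀ a, P₁ a ≠ 0) (hP₂ : ∀ a, P₂ a ≠ 0) (hN : N ≠ 0) {n : ℕ}
    (hn : n ∈ Finset.Icc 1 (N ^ 2)) (i : Hyp) :
    law P₁ P₂ N i {s | γ * N ≤ score i n (toData s)} ≤
      ENNReal.ofReal (Real.exp (-(γ * N)) * ((N : ℝ) + 1) ^ (3 * Fintype.card X)) := by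
  have hN' : (0 : ℝ) < N := Nat.cast_pos.2 (Nat.pos_of_ne_zero hN)
  have hn' : (0 : ℝ) < n := Nat.cast_pos.2 (Finset.mem_Icc.1 hn).1
  refine law_empType_mem_le hP₁ hP₂ hN hn i i {Q | γ * N ≤ n * gjs Q.1 Q.2 ((N : ℝ) / n)}
    fun Q hQ hscore => le_of_mul_le_mul_right ?_ hN'
  calc γ * N ≤ n * gjs Q.1 Q.2 ((N : ℝ) / n) := hscore
    _ ≤ n * ((N : ℝ) / n * typeCost (vec (source P₁ P₂ i)) (vec (source P₁ P₂ i)) (N / n) Q) := by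
        gcongr
        exact gjs_le_mul_typeCost (vec_mem_stdSimplex _) (vec_pos (source_ne_zero hP₁ hP₂ i))
          (div_pos hN' hn') hQ
    _ = typeCost (vec (source P₁ P₂ i)) (vec (source P₁ P₂ i)) (N / n) Q * N := by field_simp

lemma eventually_law_score_lt_le (hP₁ : ∀ a, P₁ a ≠ 0) (hP₂ : ∀ a, P₂ a ≠ 0) {i j : Hyp}
    (hij : i ≠ j) (hγ : γ ∈ Set.Ioc 0 (chernoff (vec P₁) (vec P₂))) {ε : ℝ} (hε : 0 < ε) :
    ∀ᶠ N : ℕ in atTop, law P₁ P₂ N i {s | score j (N ^ 2) (toData s) < γ * N} ≤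
      ENNReal.ofReal (Real.exp (-((γ - ε) * N)) * ((N : ℝ) + 1) ^ (3 * Fintype.card X)) := by
  have hchernoff : chernoff (vec (source P₁ P₂ i)) (vec (source P₁ P₂ j)) =
      chernoff (vec P₁) (vec P₂) := by
    cases i <;> cases j
    exacts [absurd rfl hij, rfl, chernoff_comm _ _, absurd rfl hij]
  have hratio : Tendsto (fun N : ℕ => (N : ℝ) / (N ^ 2 : ℕ)) atTop (𝓝[>] 0) := by
    refine (tendsto_inv_atTop_nhdsGT_zero.comp tendsto_natCast_atTop_atTop).congr fun N => ?_
    rw [Function.comp_apply, Nat.cast_pow, sq, div_self_mul_self']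
  filter_upwards [hratio.eventually (eventually_sub_le_typeCost (vec_mem_stdSimplex _)
    (vec_mem_stdSimplex _) (vec_pos (source_ne_zero hP₁ hP₂ i))
    (vec_pos (source_ne_zero hP₁ hP₂ j)) (hchernoff ▸ hγ) hε), eventually_ne_atTop 0] with N hN hN₀
  have hsq : (0 : ℝ) < (N ^ 2 : ℕ) := Nat.cast_pos.2 (pow_pos (Nat.pos_of_ne_zero hN₀) 2)
  refine law_empType_mem_le hP₁ hP₂ hN₀ (Finset.mem_Icc.2 ⟨Nat.cast_pos.1 hsq, le_rfl⟩) j i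
    {Q | (N ^ 2 : ℕ) * gjs Q.1 Q.2 ((N : ℝ) / (N ^ 2 : ℕ)) < γ * N} fun Q hQ hscore => hN Q hQ ?_
  rwa [← mul_div_assoc, lt_div_iff₀' hsq]

lemma eventually_errProb_seq_le (hP₁ : ∀ a, P₁ a ≠ 0) (hP₂ : ∀ a, P₂ a ≠ 0)
    (hγ : γ ∈ Set.Ioc 0 (chernoff (vec P₁) (vec P₂))) {Φ : ∀ N, Test X N}
    (hΦ : ∀ N, IsSeqTest γ (Φ N)) (i : Hyp) {d : ℝ} (hd : d < γ) :
    ∀ᶠ N : ℕ in atTop, errProb P₁ P₂ (Φ N) i ≤ ENNReal.ofReal (Real.exp (-(d * N))) := by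
  obtain ⟨j, hij⟩ : ∃ j, i ≠ j := by
    cases i
    exacts [⟨.H₂, nofun⟩, ⟨.H₁, nofun⟩]
  obtain ⟨c, hdc, hcγ⟩ := exists_between hd
  filter_upwards [eventually_law_score_lt_le hP₁ hP₂ hij hγ (sub_pos.2 hcγ),
    eventually_pow_le_exp (3 * Fintype.card X + 2) (sub_pos.2 hdc), eventually_ne_atTop 0]
    with N hother hpow hN
  rw [sub_sub_cancel] at hother
  let B : ℝ := Real.exp (-(c * N)) * ((N : ℝ) + 1) ^ (3 * Fintype.card X)
  have hown : ∀ n ∈ Finset.Icc 1 (N ^ 2),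
      law P₁ P₂ N i {s | γ * N ≤ score i n (toData s)} ≤ ENNReal.ofReal B := fun n hn =>
    (law_le_score_le hP₁ hP₂ hN hn i).trans (ENNReal.ofReal_le_ofReal (by simp only [B]; gcongr))
  calc errProb P₁ P₂ (Φ N) i
      ≤ ∑ _n ∈ Finset.Icc 1 (N ^ 2), ENNReal.ofReal B + ENNReal.ofReal B :=
        ((hΦ N).errProb_le hN hij).trans (add_le_add (Finset.sum_le_sum hown) hother)
    _ = ENNReal.ofReal (((N ^ 2 : ℕ) + 1) * B) := by
        rw [Finset.sum_const, Nat.card_Icc, add_tsub_cancel_right, ← succ_nsmul,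
          ← ENNReal.ofReal_nsmul, nsmul_eq_mul, Nat.cast_succ]
    _ ≤ ENNReal.ofReal (Real.exp (-(d * N))) := by
        refine ENNReal.ofReal_le_ofReal ?_
        calc ((N ^ 2 : ℕ) + 1) * B ≤ ((N : ℝ) + 1) ^ 2 * B := by
              gcongr
              push_cast
              nlinarith [Nat.cast_nonneg (α := ℝ) N]
          _ = Real.exp (-(c * N)) * ((N : ℝ) + 1) ^ (3 * Fintype.card X + 2) := by ring
          _ ≤ Real.exp (-(c * N)) * Real.exp ((c - d) * N) := by gcongr
          _ = Real.exp (-(d * N)) := by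
              rw [← Real.exp_add]
              ring_nf

lemma le_bayesExponent_seq (hP₁ : ∀ a, P₁ a ≠ 0) (hP₂ : ∀ a, P₂ a ≠ 0) {p : ℝ}
    (hp : p ∈ Set.Icc (0 : ℝ) 1) (hγ : γ ∈ Set.Ioc 0 (chernoff (vec P₁) (vec P₂)))
    {Φ : ∀ N, Test X N} (hΦ : ∀ N, IsSeqTest γ (Φ N)) :
    (γ : EReal) ≤ bayesExponent P₁ P₂ p Φ :=
  le_bayesExponent hp fun _ hd i => eventually_errProb_seq_le hP₁ hP₂ hγ hΦ i hd

end SequentialTest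

section GutmanTest

variable {X : Type*} [Fintype X] [DecidableEq X] [MeasurableSpace X] [MeasurableSingletonClass X]
  {P₁ P₂ : PMF X}

lemma IsGutmanTest.ofReal_pairProb_le {N n : ℕ} {lam α : ℝ} {Φ : Test X N}
    (hΦ : IsGutmanTest lam α n Φ) {A : Finset ((Fin N → X) × (Fin n → X))}
    (hA : ∀ z ∈ A, gjs (empType z.1) (empType z.2) α < lam * α) :
    ENNReal.ofReal (pairProb (vec P₁) (vec P₂) A) ≤ errProb P₁ P₂ Φ .H₂ := by
  have hsub : {s | ((toData s).train .H₁, (toData s).prefix n) ∈ A} ⊆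
      {s | Φ.d (toData s) ≠ .H₂} := fun s hs => by
    have hd : Φ.d (toData s) = .H₁ :=
      (hΦ (toData s)).2.1 (hA ((toData s).train .H₁, (toData s).prefix n) hs)
    exact hd.trans_ne nofun
  exact (law_train_prefix_mem P₁ P₂ .H₁ .H₂ A).symm.trans_le (measure_mono hsub)

lemma bayesExponent_gutman_lt (hP₁ : ∀ a, P₁ a ≠ 0) (hP₂ : ∀ a, P₂ a ≠ 0) (hne : vec P₁ ≠ vec P₂)
    {p : ℝ} (hp : p < 1) {γ α : ℝ} (hα : 0 < α)
    (hγα : gjs (vec P₁) (vec P₂) α ≤ γ * α ∨ gjs (vec P₂) (vec P₁) α ≤ γ * α) {n : ℕ → ℕ}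
    (hn : Tendsto (fun N : ℕ => (N : ℝ) / n N) atTop (𝓝 α)) {lam : ℝ}
    (hlam : IsOptimalThreshold (vec P₁) (vec P₂) α lam) {Φ : ∀ N, Test X N}
    (hΦ : ∀ N, IsGutmanTest lam α (n N) (Φ N)) : bayesExponent P₁ P₂ p Φ < (γ : EReal) := by
  classical
  obtain ⟨Q, hQ, hgjs, hcost⟩ := hlam.exists_lt (vec_mem_stdSimplex P₁) (vec_mem_stdSimplex P₂)
    (vec_pos hP₁) (vec_pos hP₂) hne hα hγα
  obtain ⟨d, hcostd, hdγ⟩ := exists_between hcost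
  have hU : {R : (X → ℝ) × (X → ℝ) | gjs R.1 R.2 α < lam * α} ∈
      𝓝[stdSimplex ℝ X ×ˢ stdSimplex ℝ X] Q :=
    ((continuousOn_gjs hα).mono fun R hR => ⟨hR.1.1, hR.2.1⟩).continuousWithinAt hQ
      |>.eventually_lt_const ((div_lt_iff₀ hα).1 hgjs)
  refine (bayesExponent_le hp ?_).trans_lt (EReal.coe_lt_coe_iff.2 hdγ)
  filter_upwards [eventually_exp_le_pairProb (vec_pos hP₁) (vec_pos hP₂) hα hn hQ hU hcostd]
    with N hN
  refine (ENNReal.ofReal_le_ofReal (hN {z | gjs (empType z.1) (empType z.2) α < lam * α}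
    fun z hz => Finset.mem_filter.2 ⟨Finset.mem_univ z, hz⟩)).trans
      ((hΦ N).ofReal_pairProb_le fun z hz => (Finset.mem_filter.1 hz).2)

end GutmanTest

end SeqClass

theorem theorem3_general {X : Type*} [Fintype X] [DecidableEq X] [MeasurableSpace X]
    [MeasurableSingletonClass X] (P₁ P₂ : PMF X) (hP₁ : ∀ a, P₁ a ≠ 0) (hP₂ : ∀ a, P₂ a ≠ 0)
    (p : ℝ) (hp : p ∈ Set.Ico (0 : ℝ) 1)
    (γ : ℝ) (hγ : γ ∈ Set.Ioc 0 (chernoff (vec P₁) (vec P₂))) (α : ℝ) (hα : 0 < α)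
    (hγα : gjs (vec P₁) (vec P₂) α ≤ γ * α ∨ gjs (vec P₂) (vec P₁) α ≤ γ * α)
    (n : ℕ → ℕ) (hn : Tendsto (fun N : ℕ => (N : ℝ) / n N) atTop (𝓝 α))
    (lam : ℝ) (hlam : IsOptimalThreshold (vec P₁) (vec P₂) α lam)
    (Φseq Φgut : ∀ N : ℕ, Test X N) (hseq : ∀ N, IsSeqTest γ (Φseq N))
    (hgut : ∀ N, IsGutmanTest lam α (n N) (Φgut N)) :
    bayesExponent P₁ P₂ p Φgut < (γ : EReal) ∧
      (γ : EReal) ≤ bayesExponent P₁ P₂ p Φseq ∧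
      bayesExponent P₁ P₂ p Φgut < bayesExponent P₁ P₂ p Φseq := by
  have hne : vec P₁ ≠ vec P₂ :=
    ne_of_chernoff_pos (vec_mem_stdSimplex P₁) (vec_pos hP₁) (hγ.1.trans_le hγ.2)
  have hlt := bayesExponent_gutman_lt hP₁ hP₂ hne hp.2 hα hγα hn hlam hgut
  have hle := le_bayesExponent_seq hP₁ hP₂ (Set.Ico_subset_Icc_self hp) hγ hseq
  exact ⟨hlt, hle, hlt.trans_le hle⟩

theorem theorem3 {X : Type*} [Fintype X] [DecidableEq X] [MeasurableSpace X]
    [MeasurableSingletonClass X] (P₁ P₂ : PMF X) (hP₁ : ∀ a, P₁ a ≠ 0) (hP₂ : ∀ a, P₂ a ≠ 0)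
    (p : ℝ) (hp : p ∈ Set.Ioo (0 : ℝ) 1)
    (γ : ℝ) (hγ : γ ∈ Set.Ioc 0 (chernoff (vec P₁) (vec P₂)))
    (β θ : ℝ) (hβ : 0 < β) (hθ : 0 < θ)
    (hβγ : gjs (vec P₂) (vec P₁) β = γ * β) (hθγ : gjs (vec P₁) (vec P₂) θ = γ * θ)
    (n : ℕ → ℕ) (hn : Tendsto (fun N : ℕ => (N : ℝ) / n N) atTop (𝓝 (min θ β)))
    (lam : ℝ) (hlam : IsOptimalThreshold (vec P₁) (vec P₂) (min θ β) lam)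
    (Φseq Φgut : ∀ N : ℕ, Test X N) (hseq : ∀ N, IsSeqTest γ (Φseq N))
    (hgut : ∀ N, IsGutmanTest lam (min θ β) (n N) (Φgut N)) :
    bayesExponent P₁ P₂ p Φgut < (γ : EReal) ∧
      (γ : EReal) ≤ bayesExponent P₁ P₂ p Φseq ∧
      bayesExponent P₁ P₂ p Φgut < bayesExponent P₁ P₂ p Φseq := by
  have hγα : gjs (vec P₁) (vec P₂) (min θ β) ≤ γ * min θ β ∨
      gjs (vec P₂) (vec P₁) (min θ β) ≤ γ * min θ β := by grind
  exact theorem3_general P₁ P₂ hP₁ hP₂ p (Set.Ioo_subset_Ico_self hp) γ hγ (min θ β)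
    (lt_min hθ hβ) hγα n hn lam hlam Φseq Φgut hseq hgut
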